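/- **Model.** Work on a randomised word RAM with $w$-bit words. For data sets $x\in\mathcal X$ (an arbitrary set), a *data structure* consists of a randomised preprocessing, which maps $x$ to a random memory content (an array of words), and a query algorithm, not depending on $x$, that reads the memory and the query (an array of $\ell$ words), uses a zero-initialised workspace, and outputs a word; a query algorithm is a computation tree of unit-cost steps (word arithmetic, comparisons and bit operations, fresh uniformly random words, indirect loads and stores, branching on zero). *Space* is the number of memory words plus workspace words; *query time* is the worst-case number of steps. For each $x$ and query $q$ a set $V(x,q)$ of correct answers is given, which is an interval of integers contained in $\{0,\dots,U-1\}$. An adaptive adversary plays $Q$ rounds against a data structure: the memory is sampled once from the preprocessing of $x$; in each round the (randomised, computationally unbounded) adversary chooses a query depending on all earlier queries and responses, and the query algorithm, with fresh coins, responds to it. **Theorem.** For all $c,a\in\mathbb N$ there are constants $C>0$ and $\kappa\in\mathbb N$ such that the following holds. Let $n,Q$ be natural numbers with $nQ\ge 2$, let $U\le (nQ)^a$, and let $\mathcal D$ be a data structure of space at most $S$ (where $S\ge1$) and query time at most $T$ such that for every $x$ and every fixed query $q$ the answer of $\mathcal D$ lies in $V(x,q)$ with probability at least $3/4$ (over preprocessing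 and query algorithm). Assume that words are long enough to address the new structure: $C\,S\sqrt Q\,\log(nQ)\le 2^w$. Then there is a data structure $\mathcal D'$ whose memory is the concatenation of the memories of $r\le C\sqrt Q\log(nQ)$ independent copies of $\mathcal D$, such that 1. $\mathcal D'$ uses space at most $C\,S\sqrt Q\,\log(nQ)$; 2. $\mathcal D'$ has query time at most $C\,B\,\log^{\kappa}(2+B)$, where $B=T\log(nQ)+\log^3(nQ)$, i.e. $\widetilde O(T\log(nQ)+\log^3(nQ))$; 3. for every $x$ and every adaptive adversary, with probability at least $1-(nQ)^{-c}$ all $Q$ responses of $\mathcal D'$ are correct. -/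

import Mathlib

/-!
A randomised word RAM for static data structures: memory cells hold `w`-bit words, a query
algorithm is a finite computation tree of unit-cost instructions, and its running time is the
number of steps on the longest branch.
-/

namespace RobustDS

/-- Unit-cost operations on machine words. -/
inductive BinOp
  | add | sub | mul | div | mod | and | or | xor | shl | shr | lt | eq

/-- The value of a word operation (unsigned, modulo `2 ^ w`; comparisons return `0` or `1`). -/
def BinOp.eval {w : ℕ} : BinOp → BitVec w → BitVec w → BitVec w
  | .add, x, y => x + y
  | .sub, x, y => x - y
  | .mul, x, y => x * y
  | .div, x, y => x / y
  | .mod, x, y => x % y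
  | .and, x, y => x &&& y
  | .or, x, y => x ||| y
  | .xor, x, y => x ^^^ y
  | .shl, x, y => x <<< y
  | .shr, x, y => x >>> y
  | .lt, x, y => if x.toNat < y.toNat then 1 else 0
  | .eq, x, y => if x = y then 1 else 0

/-- Reading an array of `k` words at address `i`; addresses out of range read as `0`. -/
def readAt {w k : ℕ} (v : Fin k → BitVec w) (i : ℕ) : BitVec w :=
  if h : i < k then v ⟨i, h⟩ else 0

/-- Writing to an array of `k` words at address `i`; addresses out of range are ignored. -/
def writeAt {w k : ℕ} (v : Fin k → BitVec w) (i : ℕ) (b : BitVec w) : Fin k → BitVec w :=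
  fun j => if j.val = i then b else v j

/-- Instructions. The machine has three arrays of words: the read-only memory that stores the data
structure, the read-only query, and a read-write workspace. Natural numbers in an instruction are
fixed positions of the workspace, which serve as registers; all three arrays can be addressed
indirectly. -/
inductive Instr (w : ℕ)
  /-- `work[dst] := b` -/
  | const (dst : ℕ) (b : BitVec w)
  /-- `work[dst] := o (work[i], work[j])` -/
  | op (o : BinOp) (dst i j : ℕ)
  /-- `work[dst] :=` a fresh uniformly random word -/
  | rand (dst : ℕ)
  /-- `work[dst] := memory[work[i]]` -/
  | loadMem (dst i : ℕ)
  /-- `work[dst] := query[work[i]]` -/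
  | loadQuery (dst i : ℕ)
  /-- `work[dst] := work[work[i]]` -/
  | loadWork (dst i : ℕ)
  /-- `work[work[i]] := work[j]` -/
  | storeWork (i j : ℕ)

/-- The (random) workspace after one instruction. -/
noncomputable def Instr.exec {w m l s : ℕ} (M : Fin m → BitVec w) (q : Fin l → BitVec w)
    (W : Fin s → BitVec w) : Instr w → PMF (Fin s → BitVec w)
  | .const dst b => PMF.pure (writeAt W dst b)
  | .op o dst i j => PMF.pure (writeAt W dst (o.eval (readAt W i) (readAt W j)))
  | .rand dst => (PMF.uniformOfFintype (BitVec w)).map (writeAt W dst)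
  | .loadMem dst i => PMF.pure (writeAt W dst (readAt M (readAt W i).toNat))
  | .loadQuery dst i => PMF.pure (writeAt W dst (readAt q (readAt W i).toNat))
  | .loadWork dst i => PMF.pure (writeAt W dst (readAt W (readAt W i).toNat))
  | .storeWork i j => PMF.pure (writeAt W (readAt W i).toNat (readAt W j))

/-- Query algorithms: finite computation trees that execute instructions, branch on whether a
workspace word is zero, and finally output a workspace word. -/
inductive Prog (w : ℕ)
  /-- output `work[i]` -/
  | ret (i : ℕ)
  /-- execute an instruction and continue -/
  | step (c : Instr w) (p : Prog w)
  /-- continue with `p` if `work[i] = 0` and with `p'` otherwise -/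
  | branch (i : ℕ) (p p' : Prog w)

/-- Worst-case number of steps. -/
def Prog.time {w : ℕ} : Prog w → ℕ
  | .ret _ => 1
  | .step _ p => 1 + p.time
  | .branch _ p p' => 1 + max p.time p'.time

/-- The distribution of the output of a query algorithm. -/
noncomputable def Prog.run {w m l s : ℕ} (M : Fin m → BitVec w) (q : Fin l → BitVec w) :
    Prog w → (Fin s → BitVec w) → PMF (BitVec w)
  | .ret i, W => PMF.pure (readAt W i)
  | .step c p, W => (c.exec M q W).bind fun W' => p.run M q W'
  | .branch i p p', W => if readAt W i = 0 then p.run M q W else p'.run M q W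

/-- A randomised data structure for data sets `x : X`. Preprocessing of `x` produces a random
content of a memory of `cells` words; a query is then answered by running `prog`, which does not
depend on `x`, on the memory and the query. -/
structure DataStructure (X : Type*) (w : ℕ) where
  /-- number of words stored -/
  cells : ℕ
  /-- number of words of workspace while a query is answered -/
  work : ℕ
  /-- randomised preprocessing -/
  init : X → PMF (Fin cells → BitVec w)
  /-- query algorithm -/
  prog : Prog w

variable {X : Type*} {w : ℕ}

/-- Total space in words: stored words and workspace. -/
def DataStructure.space (D : DataStructure X w) : ℕ := D.cells + D.work

/-- Worst-case query time. -/
def DataStructure.time (D : DataStructure X w) : ℕ := D.prog.time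

/-- Distribution of the answer to the query `q` when the memory content is `M`. The workspace is
initially zero and the memory is not changed; the only randomness is that of the query algorithm. -/
noncomputable def DataStructure.answer (D : DataStructure X w) {l : ℕ}
    (M : Fin D.cells → BitVec w) (q : Fin l → BitVec w) : PMF (BitVec w) :=
  D.prog.run M q (fun _ : Fin D.work => 0)

/-- For every data set and every fixed query, the answer is valid with probability at least `p`,
over preprocessing and query algorithm. `valid x q` is the set of correct answers. -/
def DataStructure.AnswersSingle (D : DataStructure X w) {l : ℕ}
    (valid : X → (Fin l → BitVec w) → Set ℕ) (p : ENNReal) : Prop :=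
  ∀ (x : X) (q : Fin l → BitVec w),
    p ≤ ((D.init x).bind fun M => D.answer M q).toOuterMeasure {b | b.toNat ∈ valid x q}

/-- A randomised adaptive adversary: it chooses the next query from the transcript of all earlier
queries and responses (most recent first). -/
abbrev Adversary (w l : ℕ) : Type :=
  List ((Fin l → BitVec w) × BitVec w) → PMF (Fin l → BitVec w)

/-- Transcript after `t` further rounds, starting from the transcript `h`, for memory content `M`. -/
noncomputable def DataStructure.play (D : DataStructure X w) {l : ℕ}
    (M : Fin D.cells → BitVec w) (A : Adversary w l) :
    ℕ → List ((Fin l → BitVec w) × BitVec w) → PMF (List ((Fin l → BitVec w) × BitVec w))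
  | 0, h => PMF.pure h
  | t + 1, h => (A h).bind fun q => (D.answer M q).bind fun b => D.play M A t ((q, b) :: h)

/-- Transcript of the whole game: the memory is sampled once, then `t` rounds are played. -/
noncomputable def DataStructure.game (D : DataStructure X w) {l : ℕ} (x : X)
    (A : Adversary w l) (t : ℕ) : PMF (List ((Fin l → BitVec w) × BitVec w)) :=
  (D.init x).bind fun M => D.play M A t []

/-- For every data set and every adaptive adversary, with probability at least `p` all of `t`
adaptively chosen queries are answered correctly. -/
def DataStructure.AnswersAdaptive (D : DataStructure X w) {l : ℕ}
    (valid : X → (Fin l → BitVec w) → Set ℕ) (t : ℕ) (p : ENNReal) : Prop :=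
  ∀ (x : X) (A : Adversary w l),
    p ≤ (D.game x A t).toOuterMeasure {h | ∀ qb ∈ h, qb.2.toNat ∈ valid x qb.1}

/-- `r` independent samples from `P`. -/
noncomputable def iid {α : Type*} (P : PMF α) : (r : ℕ) → PMF (Fin r → α)
  | 0 => PMF.pure Fin.elim0
  | r + 1 => P.bind fun y => (iid P r).map fun f => (Fin.cons y f : Fin (r + 1) → α)

/-- The data structure whose memory is the concatenation of the memories of `r` independent copies
of `D`, with the query algorithm `prog` and `work` words of workspace. -/
noncomputable def DataStructure.ofCopies (D : DataStructure X w) (r work : ℕ) (prog : Prog w) :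
    DataStructure X w where
  cells := r * D.cells
  work := work
  init := fun x => (iid (D.init x) r).map fun f j => f j.divNat j.modNat
  prog := prog

end RobustDS

/-! A query is answered by a noisy binary search for a median of the answers of the copies. Each
comparison runs one uniformly random copy, and with probability 1/4 its outcome is replaced by a
fair coin. The coin makes the transcript insensitive to any small group of copies, so the adversary
cannot learn queries on which such a group fails.

Split the copies into `m` blocks of `L` copies, with `m` of order `√Q` and `L` of order `log (nQ)`.
Replacing the copies of one block by constant dummies moves the success probability of a comparison
by at most `3 / (4 * m)`. Both probabilities stay in `[1/8, 7/8]`, so `1 + χ²` is at most `1 + 6 / m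
^ 2` (`ChiSqLE.noisyTest`). These factors multiply along the game, even for adaptive queries
(`ChiSqLE.playWith`). The game has `O(Q log (nQ))` comparisons, so the total factor is at most `2 ^
Λ` with `Λ = ⌈log₂ (nQ)⌉` (`leakage_le`). The divergence is quadratic in `1 / m`, which is why about
`√Q` blocks suffice.

In the game with dummies the transcript is independent of the replaced block. By a Chernoff bound,
the block then has average error above 7/20 on some asked query with probability at most `Q *
(399/400) ^ L`. Cauchy–Schwarz transfers this to the real game at the price of a square root and the
factor above (`expect_block_bad_sq_le`).

If no block is bad, the average error over all copies is at most 7/20 on every asked query.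
Comparisons next to a value outside the interval of correct answers are then biased in the right
direction by a constant. A multiplicative-weights search on `{0, …, N - 1}` exploits this and fails
with probability at most `N * (999/1000) ^ k` (`expect_search_wrong_le`). A union bound over blocks
and rounds finishes (`expect_game_wrong_le`).

On the machine, the weights of the search depend only on earlier comparison outcomes. They are
therefore hard-wired into the computation tree and cost no time (`run_searchProg`). -/

open scoped ENNReal

namespace RobustDS

/-! ### Expectations with values in `ℝ≥0∞`. -/

section Expect

variable {α β : Type*}

/-- Expectation of a nonnegative function. -/
noncomputable def expect (P : PMF α) (F : α → ℝ≥0∞) : ℝ≥0∞ := ∑' a, P a * F a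

theorem expect_pure (a : α) (F : α → ℝ≥0∞) : expect (PMF.pure a) F = F a := by
  unfold expect
  rw [tsum_eq_single a]
  · simp
  · intro b hb
    simp [PMF.pure_apply, hb]

theorem expect_bind (P : PMF α) (f : α → PMF β) (F : β → ℝ≥0∞) :
    expect (P.bind f) F = expect P fun a => expect (f a) F := by
  unfold expect
  simp only [PMF.bind_apply, ← ENNReal.tsum_mul_right, ← ENNReal.tsum_mul_left]
  rw [ENNReal.tsum_comm]
  simp only [mul_assoc]

theorem expect_map (P : PMF α) (f : α → β) (F : β → ℝ≥0∞) :
    expect (P.map f) F = expect P fun a => F (f a) := by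
  rw [← PMF.bind_pure_comp, expect_bind]
  simp [expect_pure]

theorem expect_mono (P : PMF α) {F G : α → ℝ≥0∞} (h : ∀ a, F a ≤ G a) :
    expect P F ≤ expect P G :=
  ENNReal.tsum_le_tsum fun a => mul_le_mul_right (h a) _

theorem expect_mono_support (P : PMF α) {F G : α → ℝ≥0∞} (h : ∀ a ∈ P.support, F a ≤ G a) :
    expect P F ≤ expect P G := by
  refine ENNReal.tsum_le_tsum fun a => ?_
  by_cases ha : P a = 0
  · simp [ha]
  · exact mul_le_mul_right (h a ((P.mem_support_iff a).2 ha)) _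

theorem expect_add (P : PMF α) (F G : α → ℝ≥0∞) :
    (expect P fun a => F a + G a) = expect P F + expect P G := by
  unfold expect
  simp only [mul_add]
  exact ENNReal.tsum_add

theorem expect_mul_left (P : PMF α) (c : ℝ≥0∞) (F : α → ℝ≥0∞) :
    (expect P fun a => c * F a) = c * expect P F := by
  unfold expect
  rw [← ENNReal.tsum_mul_left]
  exact tsum_congr fun a => by ring

theorem expect_const (P : PMF α) (c : ℝ≥0∞) : (expect P fun _ => c) = c := by
  unfold expect
  rw [ENNReal.tsum_mul_right, P.tsum_coe, one_mul]

theorem expect_finset_sum {ι : Type*} (P : PMF α) (s : Finset ι) (F : ι → α → ℝ≥0∞) :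
    (expect P fun a => ∑ i ∈ s, F i a) = ∑ i ∈ s, expect P (F i) := by
  classical
  induction s using Finset.induction_on with
  | empty => simp [expect_const]
  | insert i s hi ih => simp only [Finset.sum_insert hi, expect_add, ih]

theorem expect_le_of_le (P : PMF α) {F : α → ℝ≥0∞} {c : ℝ≥0∞} (h : ∀ a, F a ≤ c) :
    expect P F ≤ c :=
  (expect_mono P h).trans (expect_const P c).le

theorem expect_indicator (P : PMF α) (s : Set α) :
    expect P (s.indicator 1) = P.toOuterMeasure s := by
  unfold expect
  rw [PMF.toOuterMeasure_apply]
  refine tsum_congr fun a => ?_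
  by_cases ha : a ∈ s <;> simp [ha]

theorem expect_fintype [Fintype α] (P : PMF α) (F : α → ℝ≥0∞) :
    expect P F = ∑ a, P a * F a :=
  tsum_fintype _

theorem expect_bool (P : PMF Bool) (F : Bool → ℝ≥0∞) :
    expect P F = P true * F true + P false * F false := by
  rw [expect_fintype, Fintype.sum_bool]

theorem expect_uniform [Fintype α] [Nonempty α] (F : α → ℝ≥0∞) :
    expect (PMF.uniformOfFintype α) F = (Fintype.card α : ℝ≥0∞)⁻¹ * ∑ a, F a := by
  rw [expect_fintype, Finset.mul_sum]
  simp

theorem apply_eq_expect (P : PMF α) [DecidableEq α] (a : α) :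
    P a = expect P fun b => if b = a then 1 else 0 := by
  unfold expect
  rw [tsum_eq_single a]
  · simp
  · intro b hb
    simp [hb]

theorem two_mul_le_sq_add_sq (a b : ℝ≥0∞) : 2 * (a * b) ≤ a ^ 2 + b ^ 2 := by
  by_cases ha : a = ∞
  · simp [ha]
  by_cases hb : b = ∞
  · simp [hb]
  lift a to NNReal using ha
  lift b to NNReal using hb
  norm_cast
  rw [← mul_assoc]
  exact two_mul_le_add_sq a b

/-- Integrate `2ab ≤ a² + b²` over two independent samples; this also covers infinite values. -/
theorem expect_sq_le (P : PMF α) (F : α → ℝ≥0∞) :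
    expect P F ^ 2 ≤ expect P fun a => F a ^ 2 := by
  have h1 : expect P F ^ 2 = expect P fun a => expect P fun b => F a * F b := by
    simp only [expect_mul_left]
    rw [sq, ← expect_mul_left]
    congr 1
    ext a
    rw [mul_comm]
  have h2 : 2 * expect P F ^ 2 ≤ 2 * expect P fun a => F a ^ 2 := by
    rw [h1, ← expect_mul_left]
    simp only [← expect_mul_left P 2]
    calc (expect P fun a => expect P fun b => 2 * (F a * F b))
        ≤ expect P fun a => expect P fun b => F a ^ 2 + F b ^ 2 :=
          expect_mono P fun a => expect_mono P fun b => two_mul_le_sq_add_sq _ _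
      _ = _ := by
          simp only [expect_add, expect_const, expect_mul_left]
          rw [two_mul]
  exact (ENNReal.mul_le_mul_iff_right (by simp) (by simp)).1 h2

end Expect

/-! ### Chi-square divergence and its composition. -/

section ChiSquare

variable {α β : Type*}

/-- A quantitative form of absolute continuity: `1 + χ²(P ‖ P') ≤ K`, in the dual formulation. -/
def ChiSqLE (K : ℝ≥0∞) (P P' : PMF α) : Prop :=
  ∀ F : α → ℝ≥0∞, expect P F ^ 2 ≤ K * expect P' fun a => F a ^ 2

theorem ChiSqLE.refl (P : PMF α) : ChiSqLE 1 P P := fun F => by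
  rw [one_mul]
  exact expect_sq_le P F

/-- Chain rule: use the outer bound for the inner expectation, then the inner bound pointwise. Since
`K'` is uniform in `a`, adaptive choices cost nothing extra. -/
theorem ChiSqLE.bind {K K' : ℝ≥0∞} {P P' : PMF α} {f f' : α → PMF β} (h : ChiSqLE K P P')
    (hf : ∀ a, ChiSqLE K' (f a) (f' a)) : ChiSqLE (K * K') (P.bind f) (P'.bind f') := by
  intro F
  rw [expect_bind, expect_bind]
  refine (h _).trans ?_
  rw [mul_assoc, ← expect_mul_left P' K']
  exact mul_le_mul_right (expect_mono _ fun a => hf a F) _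

theorem ChiSqLE.map {K : ℝ≥0∞} {P P' : PMF α} (h : ChiSqLE K P P') (f : α → β) :
    ChiSqLE K (P.map f) (P'.map f) := by
  intro F
  rw [expect_map, expect_map]
  exact h _

/-- For two-point distributions `1 + χ² = 1 + (p - p')² / (p' (1 - p'))`. The denominator is at
least 7/64, and `9/16 * 64/7 = 36/7 ≤ 6`. -/
theorem sq_le_chiSq {p p' δ x y : ℝ} (hp' : 1 / 8 ≤ p') (hp'' : p' ≤ 7 / 8)
    (hδ : (p - p') ^ 2 ≤ 9 / 16 * δ) :
    (p * x + (1 - p) * y) ^ 2 ≤ (1 + 6 * δ) * (p' * x ^ 2 + (1 - p') * y ^ 2) := by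
  have hv : 7 / 64 ≤ p' * (1 - p') := by nlinarith
  have hδ0 : 0 ≤ δ := by nlinarith [sq_nonneg (p - p')]
  have hE : 0 ≤ p' * x ^ 2 + (1 - p') * y ^ 2 := by
    have := sq_nonneg x
    have := sq_nonneg y
    have h1 : 0 ≤ p' := by linarith
    have h2 : 0 ≤ 1 - p' := by linarith
    positivity
  have key : p' * (1 - p') * (p * x + (1 - p) * y) ^ 2 ≤
      (p' * (1 - p') + (p - p') ^ 2) * (p' * x ^ 2 + (1 - p') * y ^ 2) := by
    -- Lagrange's identity: the defect in Cauchy–Schwarz is a perfect square.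
    have : (p' * (1 - p') + (p - p') ^ 2) * (p' * x ^ 2 + (1 - p') * y ^ 2) -
      p' * (1 - p') * (p * x + (1 - p) * y) ^ 2 =
        (p' * (1 - p) * x - p * (1 - p') * y) ^ 2 + 0 := by ring
    nlinarith [sq_nonneg (p' * (1 - p) * x - p * (1 - p') * y)]
  have h2 : (p' * (1 - p') + (p - p') ^ 2) * (p' * x ^ 2 + (1 - p') * y ^ 2) ≤
      (p' * (1 - p') * (1 + 6 * δ)) * (p' * x ^ 2 + (1 - p') * y ^ 2) := by
    apply mul_le_mul_of_nonneg_right _ hE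
    nlinarith
  have h3 : 0 < p' * (1 - p') := by linarith
  have h4 := key.trans h2
  rw [mul_assoc (p' * (1 - p'))] at h4
  exact le_of_mul_le_mul_left h4 h3

theorem ChiSqLE.of_bool {P P' : PMF Bool} {p p' δ : ℝ} (hP : P true = ENNReal.ofReal p)
    (hPf : P false = ENNReal.ofReal (1 - p)) (hp0 : 0 ≤ p) (hp1 : p ≤ 1)
    (hP' : P' true = ENNReal.ofReal p') (hPf' : P' false = ENNReal.ofReal (1 - p'))
    (hp' : 1 / 8 ≤ p') (hp'' : p' ≤ 7 / 8) (hδ : (p - p') ^ 2 ≤ 9 / 16 * δ) :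
    ChiSqLE (ENNReal.ofReal (1 + 6 * δ)) P P' := by
  have hδ0 : 0 ≤ δ := by nlinarith [sq_nonneg (p - p')]
  intro F
  rw [expect_bool, expect_bool, hP, hPf, hP', hPf']
  have hK : ENNReal.ofReal (1 + 6 * δ) ≠ 0 := by
    rw [Ne, ENNReal.ofReal_eq_zero, not_le]; positivity
  have hq : ENNReal.ofReal p' ≠ 0 := by
    rw [Ne, ENNReal.ofReal_eq_zero, not_le]; linarith
  have hq' : ENNReal.ofReal (1 - p') ≠ 0 := by
    rw [Ne, ENNReal.ofReal_eq_zero, not_le]; linarith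
  by_cases h1 : F true = ∞
  · simp [h1, ENNReal.mul_top, hK, hq]
  by_cases h2 : F false = ∞
  · simp [h2, ENNReal.mul_top, hK, hq']
  obtain ⟨x, hx0, hx⟩ : ∃ x : ℝ, 0 ≤ x ∧ F true = ENNReal.ofReal x :=
    ⟨_, ENNReal.toReal_nonneg, (ENNReal.ofReal_toReal h1).symm⟩
  obtain ⟨y, hy0, hy⟩ : ∃ x : ℝ, 0 ≤ x ∧ F false = ENNReal.ofReal x :=
    ⟨_, ENNReal.toReal_nonneg, (ENNReal.ofReal_toReal h2).symm⟩
  have e1 : 0 ≤ 1 - p := by linarith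
  have e2 : 0 ≤ 1 - p' := by linarith
  have e3 : 0 ≤ p' := by linarith
  rw [hx, hy, ← ENNReal.ofReal_pow hx0, ← ENNReal.ofReal_pow hy0, ← ENNReal.ofReal_mul hp0,
    ← ENNReal.ofReal_mul e1, ← ENNReal.ofReal_mul e3, ← ENNReal.ofReal_mul e2,
    ← ENNReal.ofReal_add (by positivity) (by positivity),
    ← ENNReal.ofReal_add (by positivity) (by positivity),
    ← ENNReal.ofReal_pow (by positivity), ← ENNReal.ofReal_mul (by positivity)]
  exact ENNReal.ofReal_le_ofReal (sq_le_chiSq hp' hp'' hδ)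

end ChiSquare

/-! ### Word arrays and random residues. -/

section Arrays

variable {w k : ℕ}

theorem readAt_writeAt (v : Fin k → BitVec w) (i j : ℕ) (b : BitVec w) :
    readAt (writeAt v i b) j = if j = i ∧ i < k then b else readAt v j := by
  unfold readAt writeAt
  by_cases hj : j < k
  · by_cases hij : j = i
    · subst hij; simp [hj]
    · simp [hj, hij]
  · by_cases hij : j = i
    · subst hij; simp [hj]
    · simp [hj, hij]

theorem readAt_writeAt_self (v : Fin k → BitVec w) {i : ℕ} (b : BitVec w) (h : i < k) :
    readAt (writeAt v i b) i = b := by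
  rw [readAt_writeAt, if_pos ⟨rfl, h⟩]

theorem readAt_writeAt_ne (v : Fin k → BitVec w) {i j : ℕ} (b : BitVec w) (h : j ≠ i) :
    readAt (writeAt v i b) j = readAt v j := by
  rw [readAt_writeAt, if_neg fun h' => h h'.1]

theorem readAt_of_le (v : Fin k → BitVec w) {i : ℕ} (h : k ≤ i) : readAt v i = 0 := by
  unfold readAt
  rw [dif_neg (by omega)]

theorem readAt_zero (i : ℕ) : readAt (fun _ : Fin k => (0 : BitVec w)) i = 0 := by
  unfold readAt
  split <;> rfl

theorem writeAt_of_le (v : Fin k → BitVec w) {i : ℕ} (b : BitVec w) (h : k ≤ i) :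
    writeAt v i b = v := by
  ext1 j
  unfold writeAt
  rw [if_neg (by omega)]

end Arrays

/-- A residue of a random word is exactly uniform when the modulus divides `2 ^ w`; for this reason
the number of copies is chosen as a power of two. -/
theorem uniform_mod {w r : ℕ} [NeZero r] (h : r ∣ 2 ^ w) :
    (PMF.uniformOfFintype (BitVec w)).map (fun b => Fin.ofNat r b.toNat) =
      PMF.uniformOfFintype (Fin r) := by
  obtain ⟨n, hn⟩ := h
  have hn0 : n ≠ 0 := by
    rintro rfl
    simp at hn
  have hn' : 2 ^ w = n * r := by rw [hn, mul_comm]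
  let e : BitVec w ≃ Fin n × Fin r :=
    BitVec.equivFin.toEquiv.trans ((finCongr hn').trans finProdFinEquiv.symm)
  have he : ∀ b : BitVec w, (e b).2 = Fin.ofNat r b.toNat := fun b => by
    apply Fin.ext
    simp [e, finProdFinEquiv, Fin.modNat]
  ext j
  rw [apply_eq_expect, expect_map, expect_uniform, PMF.uniformOfFintype_apply]
  have : ∑ b : BitVec w, (if Fin.ofNat r b.toNat = j then (1 : ℝ≥0∞) else 0) = n := by
    rw [Fintype.sum_equiv e _ (fun x => if x.2 = j then (1 : ℝ≥0∞) else 0)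
      (fun b => by rw [he]), Fintype.sum_prod_type]
    simp
  rw [this, Fintype.card_congr BitVec.equivFin.toEquiv, Fintype.card_fin, Fintype.card_fin, hn']
  have h1 : (n : ℝ≥0∞) ≠ 0 := by exact_mod_cast hn0
  have h2 : (n : ℝ≥0∞) ≠ ∞ := ENNReal.natCast_ne_top n
  rw [Nat.cast_mul, ENNReal.mul_inv (Or.inl h1) (Or.inl h2), mul_comm, ← mul_assoc,
    ENNReal.mul_inv_cancel h1 h2, one_mul]

theorem uniform_bind_mod {w r : ℕ} [NeZero r] (h : r ∣ 2 ^ w) {β : Type*} (S : ℕ → PMF β) :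
    ((PMF.uniformOfFintype (BitVec w)).bind fun b => S (b.toNat % r)) =
      (PMF.uniformOfFintype (Fin r)).bind fun j => S j := by
  rw [← uniform_mod h, PMF.bind_map]
  rfl

/-! ### Simulating one copy inside a larger memory and workspace. -/

section Simulation

variable {w : ℕ}

/-- Workspace position that is read in place of position `i` of a simulated workspace of `s` words
stored at address `off`. -/
def readPos (off s i : ℕ) : ℕ := if i < s then off + i else 0

/-- Workspace position that is written in place of position `i` of a simulated workspace. -/
def writePos (off s i : ℕ) : ℕ := if i < s then off + i else 1

/-- Simulation of an instruction on the copy whose memory of `cells` words starts at the address in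
register `2` and whose workspace of `s` words starts at `off`. -/
def simInstr (cells s off : ℕ) : Instr w → Prog w → Prog w
  | .const dst b, k => .step (.const (writePos off s dst) b) k
  | .op o dst i j, k =>
      .step (.op o (writePos off s dst) (readPos off s i) (readPos off s j)) k
  | .rand dst, k => .step (.rand (writePos off s dst)) k
  | .loadQuery dst i, k => .step (.loadQuery (writePos off s dst) (readPos off s i)) k
  | .loadMem dst i, k =>
      .step (.const 3 (BitVec.ofNat w cells)) <| .step (.op .lt 4 (readPos off s i) 3) <|
        .branch 4 (.step (.const (writePos off s dst) 0) k) <|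
          .step (.op .add 3 (readPos off s i) 2) <| .step (.loadMem (writePos off s dst) 3) k
  | .loadWork dst i, k =>
      .step (.const 3 (BitVec.ofNat w s)) <| .step (.op .lt 4 (readPos off s i) 3) <|
        .branch 4 (.step (.const (writePos off s dst) 0) k) <|
          .step (.const 5 (BitVec.ofNat w off)) <|
            .step (.op .add 3 (readPos off s i) 5) <| .step (.loadWork (writePos off s dst) 3) k
  | .storeWork i j, k =>
      .step (.const 3 (BitVec.ofNat w s)) <| .step (.op .lt 4 (readPos off s i) 3) <|
        .branch 4 k <|
          .step (.const 5 (BitVec.ofNat w off)) <|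
            .step (.op .add 3 (readPos off s i) 5) <| .step (.storeWork 3 (readPos off s j)) k

/-- Simulation of a query algorithm; the continuation receives the position of its output. -/
def simProg (cells s off : ℕ) : Prog w → (ℕ → Prog w) → Prog w
  | .ret i, k => k (readPos off s i)
  | .step c p, k => simInstr cells s off c (simProg cells s off p k)
  | .branch i p p', k =>
      .branch (readPos off s i) (simProg cells s off p k) (simProg cells s off p' k)

theorem time_simInstr_le (cells s off : ℕ) (c : Instr w) (k : Prog w) :
    (simInstr cells s off c k).time ≤ 6 + k.time := by
  cases c <;> simp only [simInstr, Prog.time] <;> omega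

theorem time_simProg_le (cells s off : ℕ) (p : Prog w) {k : ℕ → Prog w} {t : ℕ}
    (hk : ∀ i, (k i).time ≤ t) : (simProg cells s off p k).time ≤ 6 * p.time + t := by
  induction p with
  | ret i =>
    simp only [simProg, Prog.time]
    have := hk (readPos off s i)
    omega
  | step c p ih =>
    simp only [simProg, Prog.time]
    have := time_simInstr_le cells s off c (simProg cells s off p k)
    omega
  | branch i p p' ih ih' =>
    simp only [simProg, Prog.time]
    omega

/-- The workspace `W` holds a simulated workspace `V` at address `off` and the address of the memory
in register `2`; register `0` is zero, and nothing has been written behind the block of `V`. -/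
structure Simulates {tot s : ℕ} (off : ℕ) (base : BitVec w) (W : Fin tot → BitVec w)
    (V : Fin s → BitVec w) : Prop where
  block : ∀ a < s, readAt W (off + a) = readAt V a
  zero : readAt W 0 = 0
  base : readAt W 2 = base
  fresh : ∀ a, off + s ≤ a → readAt W a = 0

variable {tot s off : ℕ} {base : BitVec w} {W : Fin tot → BitVec w} {V : Fin s → BitVec w}

theorem Simulates.read (h : Simulates off base W V) (i : ℕ) :
    readAt W (readPos off s i) = readAt V i := by
  unfold readPos
  split_ifs with hi
  · exact h.block i hi
  · rw [h.zero, readAt_of_le _ (by omega)]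

theorem Simulates.writeReg (h : Simulates off base W V) (hoff : 6 ≤ off) {i : ℕ} (b : BitVec w)
    (h0 : i ≠ 0) (h2 : i ≠ 2) (h6 : i < 6) : Simulates off base (writeAt W i b) V where
  block a ha := by rw [readAt_writeAt_ne _ _ (by omega), h.block a ha]
  zero := by rw [readAt_writeAt_ne _ _ (by omega), h.zero]
  base := by rw [readAt_writeAt_ne _ _ (by omega), h.base]
  fresh a ha := by rw [readAt_writeAt_ne _ _ (by omega), h.fresh a ha]

/-- A write past the simulated workspace has no effect there; it is diverted to register `1`, on
which `Simulates` imposes nothing. -/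
theorem Simulates.write (h : Simulates off base W V) (hoff : 6 ≤ off) (htot : off + s ≤ tot)
    (i : ℕ) (b : BitVec w) :
    Simulates off base (writeAt W (writePos off s i) b) (writeAt V i b) := by
  unfold writePos
  split_ifs with hi
  · refine ⟨fun a ha => ?_, ?_, ?_, fun a ha => ?_⟩
    · rw [readAt_writeAt, readAt_writeAt, h.block a ha]
      have : off + i < tot := by omega
      simp [hi, this]
    · rw [readAt_writeAt_ne _ _ (by omega), h.zero]
    · rw [readAt_writeAt_ne _ _ (by omega), h.base]
    · rw [readAt_writeAt_ne _ _ (by omega), h.fresh a ha]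
  · rw [writeAt_of_le V b (by omega)]
    exact h.writeReg hoff b (by omega) (by omega) (by omega)

variable {m m' l : ℕ} {Mem : Fin m' → BitVec w} {M : Fin m → BitVec w}
  {q : Fin l → BitVec w}

theorem run_step_const (dst : ℕ) (b : BitVec w) (k : Prog w) :
    (Prog.step (.const dst b) k).run Mem q W = k.run Mem q (writeAt W dst b) := by
  simp [Prog.run, Instr.exec]

theorem run_step_op (o : BinOp) (dst i j : ℕ) (k : Prog w) :
    (Prog.step (.op o dst i j) k).run Mem q W =
      k.run Mem q (writeAt W dst (o.eval (readAt W i) (readAt W j))) := by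
  simp [Prog.run, Instr.exec]

theorem run_step_loadMem (dst i : ℕ) (k : Prog w) :
    (Prog.step (.loadMem dst i) k).run Mem q W =
      k.run Mem q (writeAt W dst (readAt Mem (readAt W i).toNat)) := by
  simp [Prog.run, Instr.exec]

theorem run_step_loadQuery (dst i : ℕ) (k : Prog w) :
    (Prog.step (.loadQuery dst i) k).run Mem q W =
      k.run Mem q (writeAt W dst (readAt q (readAt W i).toNat)) := by
  simp [Prog.run, Instr.exec]

theorem run_step_loadWork (dst i : ℕ) (k : Prog w) :
    (Prog.step (.loadWork dst i) k).run Mem q W =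
      k.run Mem q (writeAt W dst (readAt W (readAt W i).toNat)) := by
  simp [Prog.run, Instr.exec]

theorem run_step_storeWork (i j : ℕ) (k : Prog w) :
    (Prog.step (.storeWork i j) k).run Mem q W =
      k.run Mem q (writeAt W (readAt W i).toNat (readAt W j)) := by
  simp [Prog.run, Instr.exec]

theorem run_step_rand (dst : ℕ) (k : Prog w) :
    (Prog.step (.rand dst) k).run Mem q W =
      (PMF.uniformOfFintype (BitVec w)).bind fun b => k.run Mem q (writeAt W dst b) := by
  simp only [Prog.run, Instr.exec, PMF.bind_map]
  rfl

theorem run_branch (i : ℕ) (p p' : Prog w) :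
    (Prog.branch i p p').run Mem q W =
      if readAt W i = 0 then p.run Mem q W else p'.run Mem q W := by
  simp [Prog.run]

theorem lt_eval_eq_zero_iff (hw : w ≠ 0) (x y : BitVec w) :
    BinOp.lt.eval x y = 0 ↔ y.toNat ≤ x.toNat := by
  change (if x.toNat < y.toNat then (1 : BitVec w) else 0) = 0 ↔ _
  split_ifs with h
  · have : (1 : BitVec w) ≠ 0 := by
      intro h1
      have := congrArg BitVec.toNat h1
      have h2 : 1 < 2 ^ w := Nat.one_lt_two_pow hw
      simp [Nat.mod_eq_of_lt h2] at this
    simp only [this, false_iff]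
    omega
  · simp only [true_iff]
    omega

/-- Bounds under which addresses of a simulated copy do not overflow. -/
structure Addressable (w m tot s off : ℕ) (base : BitVec w) : Prop where
  le_off : 6 ≤ off
  le_tot : off + s ≤ tot
  tot_lt : tot < 2 ^ w
  mem_lt : base.toNat + m < 2 ^ w

theorem Addressable.width_ne_zero (hA : Addressable w m tot s off base) : w ≠ 0 := by
  rintro rfl
  have := hA.le_off
  have := hA.le_tot
  have := hA.tot_lt
  omega

/-- Indirect accesses need an explicit range check: an address out of range for the copy may be in
range for the large arrays, where it would hit foreign data. `Addressable` excludes wrap-around when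
the base is added. -/
theorem run_simInstr (hA : Addressable w m tot s off base)
    (hM : ∀ a < m, readAt Mem (base.toNat + a) = readAt M a) (c : Instr w) {k : Prog w}
    {S : (Fin s → BitVec w) → PMF (BitVec w)}
    (hk : ∀ (W : Fin tot → BitVec w) V, Simulates off base W V → k.run Mem q W = S V)
    (h : Simulates off base W V) :
    (simInstr m s off c k).run Mem q W = (c.exec M q V).bind S := by
  have hoff := hA.le_off
  have htot := hA.le_tot
  have htot' := hA.tot_lt
  have hmem := hA.mem_lt
  have hw := hA.width_ne_zero
  have t3 : 3 < tot := by omega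
  have t4 : 4 < tot := by omega
  have t5 : 5 < tot := by omega
  cases c with
  | const dst b =>
    rw [simInstr, run_step_const, hk _ _ (h.write hoff htot dst b), Instr.exec, PMF.pure_bind]
  | op o dst i j =>
    rw [simInstr, run_step_op, hk _ _ (h.write hoff htot dst _), Instr.exec, PMF.pure_bind,
      h.read, h.read]
  | rand dst =>
    rw [simInstr, run_step_rand, Instr.exec, PMF.bind_map]
    congr 1
    ext1 b
    exact hk _ _ (h.write hoff htot dst b)
  | loadQuery dst i =>
    rw [simInstr, run_step_loadQuery, hk _ _ (h.write hoff htot dst _), Instr.exec,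
      PMF.pure_bind, h.read]
  | loadMem dst i =>
    have h1 := h.writeReg hoff (i := 3) (BitVec.ofNat w m) (by omega) (by omega) (by omega)
    have h2 := h1.writeReg hoff (i := 4)
      (BinOp.lt.eval (readAt V i) (BitVec.ofNat w m)) (by omega) (by omega) (by omega)
    have hm : (BitVec.ofNat w m).toNat = m := by
      rw [BitVec.toNat_ofNat, Nat.mod_eq_of_lt (by omega)]
    rw [simInstr, run_step_const, run_step_op, run_branch, h1.read, readAt_writeAt_self _ _ t3,
      readAt_writeAt_self _ _ t4, Instr.exec, PMF.pure_bind]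
    simp only [lt_eval_eq_zero_iff hw, hm]
    split_ifs with hi
    · rw [run_step_const, hk _ _ (h2.write hoff htot dst _), readAt_of_le M hi]
    · have hi' : (readAt V i).toNat < m := by omega
      have h3 := h2.writeReg hoff (i := 3) (BinOp.add.eval (readAt V i) base)
        (by omega) (by omega) (by omega)
      rw [run_step_op, run_step_loadMem, h2.read, h2.base, readAt_writeAt_self _ _ t3,
        hk _ _ (h3.write hoff htot dst _)]
      have e : (BinOp.add.eval (readAt V i) base).toNat = base.toNat + (readAt V i).toNat := by
        change (readAt V i + base).toNat = _
        rw [BitVec.toNat_add, Nat.mod_eq_of_lt (by omega), add_comm]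
      rw [e, hM _ hi']
  | loadWork dst i =>
    have h1 := h.writeReg hoff (i := 3) (BitVec.ofNat w s) (by omega) (by omega) (by omega)
    have h2 := h1.writeReg hoff (i := 4)
      (BinOp.lt.eval (readAt V i) (BitVec.ofNat w s)) (by omega) (by omega) (by omega)
    have hs : (BitVec.ofNat w s).toNat = s := by
      rw [BitVec.toNat_ofNat, Nat.mod_eq_of_lt (by omega)]
    rw [simInstr, run_step_const, run_step_op, run_branch, h1.read, readAt_writeAt_self _ _ t3,
      readAt_writeAt_self _ _ t4, Instr.exec, PMF.pure_bind]
    simp only [lt_eval_eq_zero_iff hw, hs]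
    split_ifs with hi
    · rw [run_step_const, hk _ _ (h2.write hoff htot dst _), readAt_of_le V hi]
    · have hi' : (readAt V i).toNat < s := by omega
      have h3 := h2.writeReg hoff (i := 5) (BitVec.ofNat w off)
        (by omega) (by omega) (by omega)
      have h4 := h3.writeReg hoff (i := 3) (BinOp.add.eval (readAt V i) (BitVec.ofNat w off))
        (by omega) (by omega) (by omega)
      rw [run_step_const, run_step_op, run_step_loadWork, h3.read, readAt_writeAt_self _ _ t5,
        readAt_writeAt_self _ _ t3, hk _ _ (h4.write hoff htot dst _)]
      have e : (BinOp.add.eval (readAt V i) (BitVec.ofNat w off)).toNat =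
          off + (readAt V i).toNat := by
        change (readAt V i + BitVec.ofNat w off).toNat = _
        rw [BitVec.toNat_add, BitVec.toNat_ofNat, Nat.mod_eq_of_lt (a := off) (by omega),
          Nat.mod_eq_of_lt (by omega), add_comm]
      rw [e, h4.block _ hi']
  | storeWork i j =>
    have h1 := h.writeReg hoff (i := 3) (BitVec.ofNat w s) (by omega) (by omega) (by omega)
    have h2 := h1.writeReg hoff (i := 4)
      (BinOp.lt.eval (readAt V i) (BitVec.ofNat w s)) (by omega) (by omega) (by omega)
    have hs : (BitVec.ofNat w s).toNat = s := by
      rw [BitVec.toNat_ofNat, Nat.mod_eq_of_lt (by omega)]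
    rw [simInstr, run_step_const, run_step_op, run_branch, h1.read, readAt_writeAt_self _ _ t3,
      readAt_writeAt_self _ _ t4, Instr.exec, PMF.pure_bind]
    simp only [lt_eval_eq_zero_iff hw, hs]
    split_ifs with hi
    · rw [hk _ _ h2, writeAt_of_le V _ hi]
    · have hi' : (readAt V i).toNat < s := by omega
      have h3 := h2.writeReg hoff (i := 5) (BitVec.ofNat w off)
        (by omega) (by omega) (by omega)
      have h4 := h3.writeReg hoff (i := 3) (BinOp.add.eval (readAt V i) (BitVec.ofNat w off))
        (by omega) (by omega) (by omega)
      rw [run_step_const, run_step_op, run_step_storeWork, h3.read, readAt_writeAt_self _ _ t5,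
        readAt_writeAt_self _ _ t3, h4.read]
      have e : (BinOp.add.eval (readAt V i) (BitVec.ofNat w off)).toNat =
          writePos off s (readAt V i).toNat := by
        change (readAt V i + BitVec.ofNat w off).toNat = _
        rw [BitVec.toNat_add, BitVec.toNat_ofNat, Nat.mod_eq_of_lt (a := off) (by omega),
          Nat.mod_eq_of_lt (by omega), writePos, if_pos hi', add_comm]
      rw [e, hk _ _ (h4.write hoff htot _ _)]

theorem run_simProg (hA : Addressable w m tot s off base)
    (hM : ∀ a < m, readAt Mem (base.toNat + a) = readAt M a) (p : Prog w) {k : ℕ → Prog w}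
    {S : BitVec w → PMF (BitVec w)}
    (hk : ∀ (W : Fin tot → BitVec w) (V : Fin s → BitVec w) (i : ℕ), Simulates off base W V →
      (k (readPos off s i)).run Mem q W = S (readAt V i))
    (h : Simulates off base W V) :
    (simProg m s off p k).run Mem q W = (p.run M q V).bind S := by
  induction p generalizing W V with
  | ret i => rw [simProg, hk _ _ _ h, Prog.run, PMF.pure_bind]
  | step c p ih =>
    rw [simProg, run_simInstr hA hM c (fun W V h => ih h) h, Prog.run, PMF.bind_bind]
  | branch i p p' ih ih' =>
    rw [simProg, run_branch, Prog.run, h.read]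
    split_ifs
    · exact ih h
    · exact ih' h

end Simulation

/-! ### The noisy comparison and its program. -/

section NoisyTest

variable {w : ℕ}

/-- A noisy comparison of the answer of a random copy with the threshold `θ`. -/
noncomputable def noisyTest {r : ℕ} [NeZero r] (ν : Fin r → PMF (BitVec w)) (θ : ℕ) : PMF Bool :=
  (PMF.uniformOfFintype (Fin 8)).bind fun u =>
    if u = 0 then PMF.pure false
    else if u = 1 then PMF.pure true
    else (PMF.uniformOfFintype (Fin r)).bind fun j => (ν j).map fun a => decide (θ ≤ a.toNat)

/-- The instruction that stores in register `3` whether the word at position `i` is at least `θ`,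
provided that register `3` holds `θ - 1`. -/
def thresholdInstr (θ i : ℕ) : Instr w :=
  if θ = 0 then .op .eq 3 i i else .op .lt 3 3 i

/-- Implementation of `noisyTest` on the concatenation of `r` memories of `cells` words. -/
def noisyTestProg (r cells s off : ℕ) (p : Prog w) (θ : ℕ) (k : Bool → Prog w) : Prog w :=
  .step (.rand 3) <| .step (.const 4 (BitVec.ofNat w 8)) <| .step (.op .mod 3 3 4) <|
    .branch 3 (k false) <|
      .step (.const 4 (BitVec.ofNat w 1)) <| .step (.op .sub 3 3 4) <|
        .branch 3 (k true) <|
          .step (.rand 2) <| .step (.const 4 (BitVec.ofNat w r)) <| .step (.op .mod 2 2 4) <|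
            .step (.const 4 (BitVec.ofNat w cells)) <| .step (.op .mul 2 2 4) <|
              simProg cells s off p fun i =>
                .step (.const 3 (BitVec.ofNat w (θ - 1))) <| .step (thresholdInstr θ i) <|
                  .branch 3 (k false) (k true)

theorem time_noisyTestProg_le (r cells s off : ℕ) (p : Prog w) (θ : ℕ) {k : Bool → Prog w}
    {t : ℕ} (hk : ∀ b, (k b).time ≤ t) :
    (noisyTestProg r cells s off p θ k).time ≤ 6 * p.time + 15 + t := by
  have h0 := hk false
  have h1 := hk true
  have := time_simProg_le cells s off p (t := 3 + t) (k := fun i =>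
    .step (.const 3 (BitVec.ofNat w (θ - 1))) <| .step (thresholdInstr θ i) <|
      .branch 3 (k false) (k true)) (fun i => by simp only [Prog.time]; omega)
  simp only [noisyTestProg, Prog.time]
  omega

/-- Nothing has been written at `off` or behind. -/
structure Fresh {tot : ℕ} (off : ℕ) (W : Fin tot → BitVec w) : Prop where
  zero : readAt W 0 = 0
  fresh : ∀ a, off ≤ a → readAt W a = 0

variable {tot s off m l : ℕ} {W : Fin tot → BitVec w}

theorem Fresh.writeReg (h : Fresh off W) (hoff : 6 ≤ off) {i : ℕ} (b : BitVec w)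
    (h0 : i ≠ 0) (h6 : i < 6) : Fresh off (writeAt W i b) where
  zero := by rw [readAt_writeAt_ne _ _ (by omega), h.zero]
  fresh a ha := by rw [readAt_writeAt_ne _ _ (by omega), h.fresh a ha]

theorem Fresh.mono (h : Fresh off W) {off' : ℕ} (hoff : off ≤ off') : Fresh off' W :=
  ⟨h.zero, fun a ha => h.fresh a (hoff.trans ha)⟩

theorem Fresh.simulates (h : Fresh off W) :
    Simulates off (readAt W 2) W (fun _ : Fin s => (0 : BitVec w)) where
  block a _ := by rw [h.fresh _ (by omega), readAt_zero]
  zero := h.zero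
  base := rfl
  fresh a ha := h.fresh a (by omega)

/-- The next simulation starts behind the block just used, so no time is spent on clearing
workspace. -/
theorem Simulates.toFresh {base : BitVec w} {V : Fin s → BitVec w}
    (h : Simulates off base W V) : Fresh (off + s) W :=
  ⟨h.zero, h.fresh⟩

variable {m' : ℕ} {Mem : Fin m' → BitVec w} {q : Fin l → BitVec w}

/-- The threshold may be `2 ^ w`, which is not a word. Testing `θ - 1 < a` avoids it, and `θ = 0`
becomes the trivially true test. -/
theorem run_step_thresholdInstr (hw : w ≠ 0) {θ i : ℕ} (hθ : θ ≤ 2 ^ w)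
    (ht : 3 < tot) (h3 : readAt W 3 = BitVec.ofNat w (θ - 1)) (k k' : Prog w) :
    (Prog.step (thresholdInstr θ i) (.branch 3 k k')).run Mem q W =
      if θ ≤ (readAt W i).toNat then
        k'.run Mem q (writeAt W 3 1) else k.run Mem q (writeAt W 3 0) := by
  have h10 : (1 : BitVec w) ≠ 0 := by
    intro h1
    have := congrArg BitVec.toNat h1
    have h2 : 1 < 2 ^ w := Nat.one_lt_two_pow hw
    simp [Nat.mod_eq_of_lt h2] at this
  unfold thresholdInstr
  split_ifs with h0 h1 h1
  · have e : BinOp.eq.eval (readAt W i) (readAt W i) = 1 := by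
      change (if readAt W i = readAt W i then (1 : BitVec w) else 0) = 1
      rw [if_pos rfl]
    rw [run_step_op, e, run_branch, readAt_writeAt_self _ _ ht, if_neg h10]
  · omega
  · have e : BinOp.lt.eval (readAt W 3) (readAt W i) = 1 := by
      change (if (readAt W 3).toNat < (readAt W i).toNat then (1 : BitVec w) else 0) = 1
      rw [if_pos]
      rw [h3, BitVec.toNat_ofNat, Nat.mod_eq_of_lt (by omega)]
      omega
    rw [run_step_op, e, run_branch, readAt_writeAt_self _ _ ht, if_neg h10]
  · have e : BinOp.lt.eval (readAt W 3) (readAt W i) = 0 := by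
      change (if (readAt W 3).toNat < (readAt W i).toNat then (1 : BitVec w) else 0) = 0
      rw [if_neg]
      rw [h3, BitVec.toNat_ofNat, Nat.mod_eq_of_lt (by omega)]
      omega
    rw [run_step_op, e, run_branch, readAt_writeAt_self _ _ ht, if_pos rfl]

theorem run_noisyTestProg {r : ℕ} [NeZero r] {M : Fin r → Fin m → BitVec w} {p : Prog w}
    {θ : ℕ} {k : Bool → Prog w} {S : Bool → PMF (BitVec w)}
    (hr : r ∣ 2 ^ w) (h8 : 8 < 2 ^ w) (hrw : r < 2 ^ w) (hmem : r * m < 2 ^ w)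
    (hoff : 6 ≤ off) (htot : off + s ≤ tot) (htot' : tot < 2 ^ w) (hθ : θ ≤ 2 ^ w)
    (hM : ∀ (j : Fin r) (a : ℕ), a < m → readAt Mem (j * m + a) = readAt (M j) a)
    (hk : ∀ b (W : Fin tot → BitVec w), Fresh (off + s) W → (k b).run Mem q W = S b)
    (h : Fresh off W) :
    (noisyTestProg r m s off p θ k).run Mem q W =
      (noisyTest (fun j => p.run (M j) q fun _ : Fin s => 0) θ).bind S := by
  have t2 : 2 < tot := by omega
  have t3 : 3 < tot := by omega
  have t4 : 4 < tot := by omega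
  have hw : w ≠ 0 := by rintro rfl; omega
  have hm : (BitVec.ofNat w m).toNat = m := by
    have : 1 * m ≤ r * m := Nat.mul_le_mul_right m (Nat.pos_of_ne_zero (NeZero.ne r))
    rw [BitVec.toNat_ofNat, Nat.mod_eq_of_lt (by omega)]
  have hr' : (BitVec.ofNat w r).toNat = r := by
    rw [BitVec.toNat_ofNat, Nat.mod_eq_of_lt (by omega)]
  have h8' : (BitVec.ofNat w 8).toNat = 8 := by
    rw [BitVec.toNat_ofNat, Nat.mod_eq_of_lt (by omega)]
  have h1' : (BitVec.ofNat w 1).toNat = 1 := by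
    rw [BitVec.toNat_ofNat, Nat.mod_eq_of_lt (by omega)]
  -- The branch taken on the six residues modulo 8 other than 0 and 1, where a copy is really
  -- consulted.
  have hcopy : ∀ (W : Fin tot → BitVec w), Fresh off W →
      (Prog.step (.rand 2) <| .step (.const 4 (BitVec.ofNat w r)) <| .step (.op .mod 2 2 4) <|
            .step (.const 4 (BitVec.ofNat w m)) <| .step (.op .mul 2 2 4) <|
              simProg m s off p fun i =>
                .step (.const 3 (BitVec.ofNat w (θ - 1))) <| .step (thresholdInstr θ i) <|
                  .branch 3 (k false) (k true)).run Mem q W =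
        (PMF.uniformOfFintype (Fin r)).bind fun j =>
          (p.run (M j) q fun _ : Fin s => 0).bind fun a => S (decide (θ ≤ a.toNat)) := by
    intro W h
    rw [run_step_rand, ← uniform_mod hr, PMF.bind_map]
    congr 1
    ext1 b
    have hb : BinOp.mod.eval b (BitVec.ofNat w r) = BitVec.ofNat w (b.toNat % r) := by
      apply BitVec.eq_of_toNat_eq
      change (b % BitVec.ofNat w r).toNat = _
      rw [BitVec.toNat_umod, hr', BitVec.toNat_ofNat,
        Nat.mod_eq_of_lt ((Nat.mod_lt _ (Nat.pos_of_ne_zero (NeZero.ne r))).trans hrw)]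
    have hbr : b.toNat % r < r := Nat.mod_lt _ (Nat.pos_of_ne_zero (NeZero.ne r))
    have hle : (b.toNat % r) * m + m ≤ r * m := by
      calc (b.toNat % r) * m + m = (b.toNat % r + 1) * m := by ring
        _ ≤ r * m := Nat.mul_le_mul_right m hbr
    have hmul : (BinOp.mul.eval (BitVec.ofNat w (b.toNat % r)) (BitVec.ofNat w m)).toNat =
        (b.toNat % r) * m := by
      change (BitVec.ofNat w (b.toNat % r) * BitVec.ofNat w m).toNat = _
      rw [BitVec.toNat_mul, hm, BitVec.toNat_ofNat, Nat.mod_eq_of_lt (hbr.trans hrw),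
        Nat.mod_eq_of_lt (by omega)]
    rw [run_step_const, run_step_op, run_step_const, run_step_op]
    simp only [readAt_writeAt_self _ _ t2, readAt_writeAt_self _ _ t4, readAt_writeAt_ne _ _
      (show 2 ≠ 4 by decide), hb]
    have hF := ((((h.writeReg hoff (i := 2) b (by omega) (by omega)).writeReg hoff (i := 4)
      (BitVec.ofNat w r) (by omega) (by omega)).writeReg hoff (i := 2)
      (BitVec.ofNat w (b.toNat % r)) (by omega) (by omega)).writeReg hoff (i := 4)
      (BitVec.ofNat w m) (by omega) (by omega)).writeReg hoff (i := 2)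
      (BinOp.mul.eval (BitVec.ofNat w (b.toNat % r)) (BitVec.ofNat w m)) (by omega) (by omega)
    have hS := hF.simulates (s := s)
    rw [readAt_writeAt_self _ _ t2] at hS
    refine run_simProg (M := M (Fin.ofNat r b.toNat))
      ⟨hoff, htot, htot', by rw [hmul]; omega⟩
      (fun a ha => ?_) p (S := fun a => S (decide (θ ≤ a.toNat))) (fun W V i hW => ?_) hS
    · rw [hmul, ← hM _ a ha]
      rfl
    · rw [run_step_const]
      have hW3 := hW.writeReg hoff (i := 3) (BitVec.ofNat w (θ - 1)) (by omega) (by omega)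
        (by omega)
      rw [run_step_thresholdInstr hw hθ t3 (readAt_writeAt_self _ _ t3), hW3.read]
      have hF' : ∀ x, Fresh (off + s) (writeAt (writeAt W 3 (BitVec.ofNat w (θ - 1))) 3 x) :=
        fun x => hW3.toFresh.writeReg (by omega) _ (by omega) (by omega)
      split_ifs with hθi
      · rw [hk _ _ (hF' _)]
        simp [hθi]
      · rw [hk _ _ (hF' _)]
        simp [hθi]
  have hbody : ∀ b : BitVec w, (Prog.step (.const 4 (BitVec.ofNat w 8)) <|
      .step (.op .mod 3 3 4) <| .branch 3 (k false) <|
      .step (.const 4 (BitVec.ofNat w 1)) <| .step (.op .sub 3 3 4) <|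
        .branch 3 (k true) <|
          .step (.rand 2) <| .step (.const 4 (BitVec.ofNat w r)) <| .step (.op .mod 2 2 4) <|
            .step (.const 4 (BitVec.ofNat w m)) <| .step (.op .mul 2 2 4) <|
              simProg m s off p fun i =>
                .step (.const 3 (BitVec.ofNat w (θ - 1))) <| .step (thresholdInstr θ i) <|
                  .branch 3 (k false) (k true)).run Mem q (writeAt W 3 b) =
      (fun n => if n = 0 then S false else if n = 1 then S true else
        (PMF.uniformOfFintype (Fin r)).bind fun j =>
          (p.run (M j) q fun _ : Fin s => 0).bind fun a => S (decide (θ ≤ a.toNat)))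
        (b.toNat % 8) := by
    intro b
    have hmod : (BinOp.mod.eval b (BitVec.ofNat w 8)).toNat = b.toNat % 8 := by
      change (b % BitVec.ofNat w 8).toNat = _
      rw [BitVec.toNat_umod, h8']
    have hmod0 : BinOp.mod.eval b (BitVec.ofNat w 8) = 0 ↔ b.toNat % 8 = 0 := by
      rw [← BitVec.toNat_inj, hmod]
      simp
    have hFoff : off ≤ off + s := by omega
    have h1 := ((h.writeReg hoff (i := 3) b (by omega) (by omega)).writeReg hoff (i := 4)
      (BitVec.ofNat w 8) (by omega) (by omega)).writeReg hoff (i := 3)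
      (BinOp.mod.eval b (BitVec.ofNat w 8)) (by omega) (by omega)
    have h2 := (h1.writeReg hoff (i := 4) (BitVec.ofNat w 1) (by omega) (by omega)).writeReg
      hoff (i := 3) (BinOp.sub.eval (BinOp.mod.eval b (BitVec.ofNat w 8)) (BitVec.ofNat w 1))
      (by omega) (by omega)
    rw [run_step_const, run_step_op, run_branch]
    simp only [readAt_writeAt_self _ _ t3, readAt_writeAt_self _ _ t4, readAt_writeAt_ne _ _
      (show 3 ≠ 4 by decide)]
    simp only [hmod0]
    split_ifs with hb0 hb1
    · exact hk _ _ (h1.mono hFoff)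
    · rw [run_step_const, run_step_op, run_branch]
      simp only [readAt_writeAt_self _ _ t3, readAt_writeAt_self _ _ t4, readAt_writeAt_ne _ _
        (show 3 ≠ 4 by decide)]
      rw [if_pos]
      · exact hk _ _ (h2.mono hFoff)
      · have : BinOp.mod.eval b (BitVec.ofNat w 8) = BitVec.ofNat w 1 := by
          apply BitVec.eq_of_toNat_eq
          rw [hmod, h1', hb1]
        rw [this]
        exact BitVec.sub_self _
    · rw [run_step_const, run_step_op, run_branch]
      simp only [readAt_writeAt_self _ _ t3, readAt_writeAt_self _ _ t4, readAt_writeAt_ne _ _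
        (show 3 ≠ 4 by decide)]
      rw [if_neg]
      · exact hcopy _ h2
      · change ¬ (BinOp.mod.eval b (BitVec.ofNat w 8) - BitVec.ofNat w 1 = 0)
        intro h0
        have := congrArg BitVec.toNat (BitVec.sub_eq_iff_eq_add.1 h0)
        rw [hmod, show (0 : BitVec w) + BitVec.ofNat w 1 = BitVec.ofNat w 1 from
          BitVec.zero_add _, h1'] at this
        exact hb1 this
  have h8dvd : 8 ∣ 2 ^ w := by
    have : 3 ≤ w := by
      by_contra hlt
      have : 2 ^ w ≤ 2 ^ 3 := Nat.pow_le_pow_right (by omega) (by omega)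
      omega
    exact pow_dvd_pow 2 this
  rw [noisyTestProg, run_step_rand]
  simp only [hbody]
  rw [uniform_bind_mod h8dvd (fun n => if n = 0 then S false else if n = 1 then S true else
        (PMF.uniformOfFintype (Fin r)).bind fun j =>
          (p.run (M j) q fun _ : Fin s => 0).bind fun a => S (decide (θ ≤ a.toNat))),
    noisyTest, PMF.bind_bind]
  congr 1
  ext1 u
  have e0 : (u : ℕ) = 0 ↔ u = 0 := by omega
  have e1 : (u : ℕ) = 1 ↔ u = 1 := by omega
  simp only [e0, e1]
  split_ifs
  · rw [PMF.pure_bind]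
  · rw [PMF.pure_bind]
  · rw [PMF.bind_bind]
    congr 1
    ext1 j
    rw [PMF.bind_map]
    rfl

end NoisyTest

/-! ### Noisy binary search by multiplicative weights. -/

section NoisySearch

/-- Weighted median of a weight function on `{0, …, N - 1}`. -/
noncomputable def wmedian (N : ℕ) (μ : ℕ → ℝ) : ℕ :=
  sInf {v | (∑ u ∈ Finset.range N, μ u) / 2 ≤ ∑ u ∈ Finset.range (v + 1), μ u}

section Median

variable {N : ℕ} {μ : ℕ → ℝ}

theorem wmedian_mem (hN : 0 < N) (hμ : ∀ v, 0 ≤ μ v) :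
    (∑ u ∈ Finset.range N, μ u) / 2 ≤ ∑ u ∈ Finset.range (wmedian N μ + 1), μ u := by
  have hne : {v | (∑ u ∈ Finset.range N, μ u) / 2 ≤
      ∑ u ∈ Finset.range (v + 1), μ u}.Nonempty := by
    refine ⟨N - 1, ?_⟩
    rw [Set.mem_ofPred_eq, Nat.sub_add_cancel hN]
    linarith [Finset.sum_nonneg fun u (_ : u ∈ Finset.range N) => hμ u]
  exact Nat.sInf_mem hne

theorem wmedian_lt (hN : 0 < N) (hμ : ∀ v, 0 ≤ μ v) : wmedian N μ < N := by
  have : wmedian N μ ≤ N - 1 := by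
    apply Nat.sInf_le
    rw [Set.mem_ofPred_eq, Nat.sub_add_cancel hN]
    linarith [Finset.sum_nonneg fun u (_ : u ∈ Finset.range N) => hμ u]
  omega

theorem sum_range_wmedian_le (hμ : ∀ v, 0 ≤ μ v) :
    ∑ u ∈ Finset.range (wmedian N μ), μ u ≤ (∑ u ∈ Finset.range N, μ u) / 2 := by
  rcases Nat.eq_zero_or_pos (wmedian N μ) with h | h
  · rw [h]
    simp only [Finset.range_zero, Finset.sum_empty]
    linarith [Finset.sum_nonneg fun u (_ : u ∈ Finset.range N) => hμ u]
  · have := Nat.notMem_of_lt_sInf (show wmedian N μ - 1 < wmedian N μ by omega)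
    rw [Set.mem_ofPred_eq, Nat.sub_add_cancel h, not_le] at this
    exact this.le

end Median

/-- Multiplicative update of the weights after a noisy comparison with threshold `θ`: the lighter
side changes by the factor `1 ± 1/40`, the heavier one so that the total weight is conserved. -/
noncomputable def update (N : ℕ) (μ : ℕ → ℝ) (θ : ℕ) (b : Bool) (v : ℕ) : ℝ :=
  let l := ∑ u ∈ Finset.range θ, μ u
  let h := ∑ u ∈ Finset.Ico θ N, μ u
  if θ ≤ v then μ v * (1 + (if b then 1 else -1) * (1 / 40) * (min l h / h))
  else μ v * (1 + (if b then -1 else 1) * (1 / 40) * (min l h / l))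

theorem min_div_mem {l h : ℝ} (hl : 0 ≤ l) (hh : 0 ≤ h) :
    (0 ≤ min l h / h ∧ min l h / h ≤ 1) ∧ 0 ≤ min l h / l ∧ min l h / l ≤ 1 := by
  have := le_min hl hh
  exact ⟨⟨by positivity, div_le_one_of_le₀ (min_le_right _ _) hh⟩, by positivity,
    div_le_one_of_le₀ (min_le_left _ _) hl⟩

section Update

variable {N : ℕ} {μ : ℕ → ℝ} {θ : ℕ}

theorem update_bounds (hμ : ∀ v, 0 ≤ μ v) (b : Bool) (v : ℕ) :
    39 / 40 * μ v ≤ update N μ θ b v ∧ update N μ θ b v ≤ 41 / 40 * μ v := by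
  obtain ⟨⟨h1, h2⟩, h3, h4⟩ := min_div_mem
    (Finset.sum_nonneg fun u (_ : u ∈ Finset.range θ) => hμ u)
    (Finset.sum_nonneg fun u (_ : u ∈ Finset.Ico θ N) => hμ u)
  unfold update
  have := hμ v
  dsimp only
  split_ifs <;> constructor <;> nlinarith

theorem update_nonneg (hμ : ∀ v, 0 ≤ μ v) (b : Bool) (v : ℕ) : 0 ≤ update N μ θ b v := by
  linarith [(update_bounds (N := N) (θ := θ) hμ b v).1, hμ v]

/-- Both sides change by the same amount `min l h / 40`, with opposite signs. If a side has weight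
zero the minimum vanishes, so division by zero does no harm. -/
theorem sum_update (hμ : ∀ v, 0 ≤ μ v) (hθ : θ ≤ N) (b : Bool) :
    ∑ v ∈ Finset.range N, update N μ θ b v = ∑ v ∈ Finset.range N, μ v := by
  have hl := Finset.sum_nonneg fun u (_ : u ∈ Finset.range θ) => hμ u
  have hh := Finset.sum_nonneg fun u (_ : u ∈ Finset.Ico θ N) => hμ u
  rw [← Finset.sum_range_add_sum_Ico _ hθ, ← Finset.sum_range_add_sum_Ico _ hθ]
  have e1 : ∑ v ∈ Finset.range θ, update N μ θ b v = ∑ v ∈ Finset.range θ, μ v *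
      (1 + (if b then -1 else 1) * (1 / 40) * (min (∑ u ∈ Finset.range θ, μ u)
        (∑ u ∈ Finset.Ico θ N, μ u) / ∑ u ∈ Finset.range θ, μ u)) := by
    refine Finset.sum_congr rfl fun v hv => ?_
    rw [Finset.mem_range] at hv
    rw [update, if_neg (by omega)]
  have e2 : ∑ v ∈ Finset.Ico θ N, update N μ θ b v = ∑ v ∈ Finset.Ico θ N, μ v *
      (1 + (if b then 1 else -1) * (1 / 40) * (min (∑ u ∈ Finset.range θ, μ u)
        (∑ u ∈ Finset.Ico θ N, μ u) / ∑ u ∈ Finset.Ico θ N, μ u)) := by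
    refine Finset.sum_congr rfl fun v hv => ?_
    rw [Finset.mem_Ico] at hv
    rw [update, if_pos (by omega)]
  rw [e1, e2, ← Finset.sum_mul, ← Finset.sum_mul]
  generalize ∑ u ∈ Finset.range θ, μ u = l at *
  generalize ∑ u ∈ Finset.Ico θ N, μ u = h at *
  have f1 : l * (min l h / l) = min l h := by
    rcases hl.eq_or_lt with h0 | h0
    · rw [← h0, min_eq_left hh]; simp
    · field_simp
  have f2 : h * (min l h / h) = min l h := by
    rcases hh.eq_or_lt with h0 | h0
    · rw [← h0, min_eq_right hl]; simp
    · field_simp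
  split_ifs
  · linear_combination (1 / 40) * f2 - (1 / 40) * f1
  · linear_combination (1 / 40) * f1 - (1 / 40) * f2

/-- The left side equals `(1 - (2p - 1) y / 40) / (1 - y² / 1600)`: a first-order gain from the bias
against a second-order loss from the noise. -/
theorem gain_le {p y c : ℝ} (hp0 : 0 ≤ p) (hp1 : p ≤ 1) (hy0 : 0 ≤ y) (hy1 : y ≤ 1)
    (hc : c ≤ (2 * p - 1) * y) :
    p * (1 / (1 + 1 / 40 * y)) + (1 - p) * (1 / (1 - 1 / 40 * y)) ≤
      (1 - c / 40) / (1 - 1 / 1600) := by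
  have h1 : 0 < 1 + 1 / 40 * y := by linarith
  have h2 : 0 < 1 - 1 / 40 * y := by linarith
  have e : p * (1 / (1 + 1 / 40 * y)) + (1 - p) * (1 / (1 - 1 / 40 * y)) =
      (1 - (2 * p - 1) * y / 40) / (1 - y ^ 2 / 1600) := by
    have h3 : 1 - y ^ 2 / 1600 = (1 + 1 / 40 * y) * (1 - 1 / 40 * y) := by ring
    have h4 : 40 - y ≠ 0 := by linarith
    have h5 : 40 + y ≠ 0 := by linarith
    rw [h3]
    field_simp
    ring
  rw [e]
  have h4 : (2 * p - 1) * y ≤ 1 := by nlinarith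
  apply div_le_div₀ <;> nlinarith

/-- The potential is the inverse weight of the target `x`. Its expected change is `gain_le` with `y`
the relative change of the side containing `x`, in units of 1/40. -/
theorem expect_inv_update_le {P : PMF Bool} {p c : ℝ} {x : ℕ} (hp0 : 0 ≤ p) (hp1 : p ≤ 1)
    (hP : P true = ENNReal.ofReal p) (hP' : P false = ENNReal.ofReal (1 - p))
    (hμ : ∀ v, 0 ≤ μ v) (hx : 0 < μ x)
    (hge : θ ≤ x → c ≤ (2 * p - 1) * (min (∑ u ∈ Finset.range θ, μ u)
      (∑ u ∈ Finset.Ico θ N, μ u) / ∑ u ∈ Finset.Ico θ N, μ u))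
    (hlt : x < θ → c ≤ (1 - 2 * p) * (min (∑ u ∈ Finset.range θ, μ u)
      (∑ u ∈ Finset.Ico θ N, μ u) / ∑ u ∈ Finset.range θ, μ u)) :
    (expect P fun b => ENNReal.ofReal (1 / update N μ θ b x)) ≤
      ENNReal.ofReal ((1 - c / 40) / (1 - 1 / 1600) * (1 / μ x)) := by
  obtain ⟨⟨h1, h2⟩, h3, h4⟩ := min_div_mem
    (Finset.sum_nonneg fun u (_ : u ∈ Finset.range θ) => hμ u)
    (Finset.sum_nonneg fun u (_ : u ∈ Finset.Ico θ N) => hμ u)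
  have hpos : ∀ b, 0 < update N μ θ b x := fun b => by
    linarith [(update_bounds (N := N) (θ := θ) hμ b x).1]
  have hpos' : ∀ b, 0 ≤ 1 / update N μ θ b x := fun b => by
    have := hpos b
    positivity
  have e1 : 0 ≤ 1 - p := by linarith
  rw [expect_bool, hP, hP', ← ENNReal.ofReal_mul hp0, ← ENNReal.ofReal_mul e1,
    ← ENNReal.ofReal_add (mul_nonneg hp0 (hpos' _)) (mul_nonneg e1 (hpos' _))]
  apply ENNReal.ofReal_le_ofReal
  have hx' : 0 ≤ 1 / μ x := by positivity
  unfold update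
  dsimp only
  by_cases hθ : θ ≤ x
  · have := mul_le_mul_of_nonneg_right (gain_le hp0 hp1 h1 h2 (hge hθ)) hx'
    simp only [hθ, if_true]
    refine le_trans (le_of_eq ?_) this
    simp only [one_div, mul_inv, Bool.false_eq_true, if_false]
    ring
  · have := mul_le_mul_of_nonneg_right (gain_le (p := 1 - p) e1 (by linarith) h3 h4
      (c := c) (by have := hlt (by omega); linarith)) hx'
    simp only [hθ, if_false]
    refine le_trans (le_of_eq ?_) this
    simp only [one_div, mul_inv, if_true, Bool.false_eq_true, if_false]
    ring

end Update

/-- The noisy binary search: `k` steps, each with two calls of the comparison oracle `orc` next to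
the weighted median. Returns the list of medians. -/
noncomputable def search (N : ℕ) (orc : ℕ → PMF Bool) : ℕ → (ℕ → ℝ) → List ℕ → PMF (List ℕ)
  | 0, _, acc => PMF.pure acc
  | k + 1, μ, acc =>
      (orc (wmedian N μ)).bind fun b => (orc (wmedian N μ + 1)).bind fun b' =>
        search N orc k (update N (update N μ (wmedian N μ) b) (wmedian N μ + 1) b')
          (wmedian N μ :: acc)

/-- Median of a list of numbers below `N`. -/
noncomputable def listMedian (N : ℕ) (acc : List ℕ) : ℕ := wmedian N fun u => (acc.count u : ℝ)

theorem sum_range_count (acc : List ℕ) (k : ℕ) :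
    ∑ u ∈ Finset.range k, (acc.count u : ℝ) = (acc.countP fun u => decide (u < k) : ℕ) := by
  induction acc with
  | nil => simp
  | cons a acc ih =>
    simp only [List.count_cons, Nat.cast_add, Finset.sum_add_distrib, ih, List.countP_cons]
    congr 1
    by_cases h : a < k <;> simp [h]

/-- If the median lies outside the convex set `I`, on one side of `x`, then so does every entry at
or beyond it on that side, and these are at least half of the list. -/
theorem length_le_of_listMedian_notMem {N : ℕ} (hN : 0 < N) {acc : List ℕ} {I : Set ℕ}
    [DecidablePred (· ∈ I)]
    (hI : I.OrdConnected) {x : ℕ} (hx : x ∈ I) (hacc : ∀ u ∈ acc, u < N)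
    (hmed : listMedian N acc ∉ I) : acc.length ≤ 2 * acc.countP fun u => decide (u ∉ I) := by
  have h0 : ∀ v, 0 ≤ (fun u => (acc.count u : ℝ)) v := fun v => Nat.cast_nonneg _
  have hmem := wmedian_mem hN h0
  have hle := sum_range_wmedian_le (N := N) h0
  change ∑ u ∈ Finset.range (listMedian N acc), _ ≤ _ at hle
  change _ ≤ ∑ u ∈ Finset.range (listMedian N acc + 1), _ at hmem
  rw [sum_range_count, sum_range_count] at hmem hle
  have htot : (acc.countP fun u => decide (u < N)) = acc.length := by
    rw [List.countP_eq_length]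
    simpa using hacc
  rw [htot] at hmem hle
  rcases lt_or_gt_of_ne (show listMedian N acc ≠ x from fun h => hmed (h ▸ hx)) with hlt | hgt
  · have : (acc.countP fun u => decide (u < listMedian N acc + 1)) ≤
        acc.countP fun u => decide (u ∉ I) := by
      apply List.countP_mono_left
      intro u _ hu
      simp only [decide_eq_true_eq] at hu ⊢
      exact fun huI => hmed (hI.out huI hx ⟨by omega, hlt.le⟩)
    have h2 : (acc.length : ℝ) ≤ 2 * (acc.countP fun u => decide (u ∉ I) : ℕ) := by
      have : ((acc.countP fun u => decide (u < listMedian N acc + 1) : ℕ) : ℝ) ≤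
        (acc.countP fun u => decide (u ∉ I) : ℕ) := by exact_mod_cast this
      linarith
    exact_mod_cast h2
  · have h1 : (acc.countP fun u => decide (¬ u < listMedian N acc)) ≤
        acc.countP fun u => decide (u ∉ I) := by
      apply List.countP_mono_left
      intro u _ hu
      simp only [decide_eq_true_eq] at hu ⊢
      exact fun huI => hmed (hI.out hx huI ⟨hgt.le, by omega⟩)
    have h3 := List.length_eq_countP_add_countP (l := acc)
      (fun u => decide (u < listMedian N acc))
    simp only [decide_eq_true_eq] at h3
    have h2 : (acc.length : ℝ) ≤ 2 * (acc.countP fun u => decide (u ∉ I) : ℕ) := by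
      have : ((acc.countP fun u => decide (¬ u < listMedian N acc) : ℕ) : ℝ) ≤
        (acc.countP fun u => decide (u ∉ I) : ℕ) := by exact_mod_cast h1
      have h4 : (acc.length : ℝ) = (acc.countP fun u => decide (u < listMedian N acc) : ℕ) +
        (acc.countP fun u => decide (¬ u < listMedian N acc) : ℕ) := by exact_mod_cast h3
      linarith
    exact_mod_cast h2

theorem search_support {N : ℕ} (hN : 0 < N) {orc : ℕ → PMF Bool} {k : ℕ} {μ : ℕ → ℝ}
    (hμ : ∀ v, 0 ≤ μ v) {acc acc' : List ℕ} (hacc : ∀ u ∈ acc, u < N)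
    (h : acc' ∈ (search N orc k μ acc).support) :
    (∀ u ∈ acc', u < N) ∧ acc'.length = k + acc.length := by
  induction k generalizing μ acc with
  | zero =>
    rw [search, PMF.mem_support_pure_iff] at h
    subst h
    exact ⟨hacc, by simp⟩
  | succ k ih =>
    rw [search] at h
    simp only [PMF.mem_support_bind_iff] at h
    obtain ⟨b, -, b', -, h⟩ := h
    have := ih (fun v => update_nonneg (fun v => update_nonneg hμ b v) b' v) (fun u hu => by
      rcases List.mem_cons.1 hu with rfl | hu
      · exact wmedian_lt hN hμ
      · exact hacc u hu) h
    refine ⟨this.1, ?_⟩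
    rw [this.2, List.length_cons]
    omega

/-- The comparison oracle is centred at `x`, and has a bias next to each point outside `I`. -/
structure OracleFor (N : ℕ) (orc : ℕ → PMF Bool) (p : ℕ → ℝ) (x : ℕ) (I : Set ℕ) : Prop where
  nonneg : ∀ θ, 0 ≤ p θ
  le_one : ∀ θ, p θ ≤ 1
  apply_true : ∀ θ, orc θ true = ENNReal.ofReal (p θ)
  apply_false : ∀ θ, orc θ false = ENNReal.ofReal (1 - p θ)
  half_le : ∀ θ ≤ x, 1 / 2 ≤ p θ
  le_half : ∀ θ, x < θ → θ ≤ N → p θ ≤ 1 / 2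
  bias_right : ∀ v, v ∉ I → v < x → 3 / 5 ≤ p (v + 1)
  bias_left : ∀ v, v ∉ I → x < v → v < N → p v ≤ 2 / 5
  lt : x < N
  mem : x ∈ I

/-- Both thresholds `v` and `v + 1` are tested because a wrong median `v` is separated from `I` by
`v + 1` if it is too small and by `v` if it is too large. The informative test has bias `2 * 3/5 - 1
= 1/5` and relative change at least 9/10, whence `9/50`. -/
theorem expect_inv_step_le {N : ℕ} {orc : ℕ → PMF Bool} {p : ℕ → ℝ} {x : ℕ} {I : Set ℕ}
    (hO : OracleFor N orc p x I) {μ : ℕ → ℝ} (hμ : ∀ v, 0 ≤ μ v)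
    (hsum : ∑ v ∈ Finset.range N, μ v = 1) (hx : 0 < μ x) {c : ℝ}
    (hc : c = 0 ∨ wmedian N μ ∉ I ∧ c = 9 / 50) :
    (expect (orc (wmedian N μ)) fun b => expect (orc (wmedian N μ + 1)) fun b' =>
      ENNReal.ofReal (1 / update N (update N μ (wmedian N μ) b) (wmedian N μ + 1) b' x)) ≤
      ENNReal.ofReal ((1 - c / 40) / (1 - 1 / 1600) ^ 2 * (1 / μ x)) := by
  have hv : wmedian N μ < N := wmedian_lt (by have := hO.lt; omega) hμ
  have hlow := sum_range_wmedian_le (N := N) hμ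
  have hupp : ∑ u ∈ Finset.Ico (wmedian N μ + 1) N, μ u ≤ 1 / 2 := by
    have h1 := wmedian_mem (N := N) (by omega) hμ
    have h2 := Finset.sum_range_add_sum_Ico μ (show wmedian N μ + 1 ≤ N from hv)
    linarith
  rw [hsum] at hlow
  set v := wmedian N μ
  have hlo0 : ∀ (μ : ℕ → ℝ) (θ : ℕ), (∀ v, 0 ≤ μ v) → 0 ≤ ∑ u ∈ Finset.range θ, μ u :=
    fun μ θ hμ => Finset.sum_nonneg fun u _ => hμ u
  have hup0 : ∀ (μ : ℕ → ℝ) (θ : ℕ), (∀ v, 0 ≤ μ v) → 0 ≤ ∑ u ∈ Finset.Ico θ N, μ u :=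
    fun μ θ hμ => Finset.sum_nonneg fun u _ => hμ u
  -- `c₁` and `c₂` are the gains credited to the two comparisons; at most one of them will be
  -- nonzero.
  suffices H : ∃ c₁ c₂ : ℝ, c₁ ≤ 1 ∧ c₂ ≤ 1 ∧ (1 - c₁ / 40) * (1 - c₂ / 40) = 1 - c / 40 ∧
      (v ≤ x → c₁ ≤ (2 * p v - 1) * (min (∑ u ∈ Finset.range v, μ u)
        (∑ u ∈ Finset.Ico v N, μ u) / ∑ u ∈ Finset.Ico v N, μ u)) ∧
      (x < v → c₁ ≤ (1 - 2 * p v) * (min (∑ u ∈ Finset.range v, μ u)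
        (∑ u ∈ Finset.Ico v N, μ u) / ∑ u ∈ Finset.range v, μ u)) ∧
      ∀ b, (v + 1 ≤ x → c₂ ≤ (2 * p (v + 1) - 1) *
          (min (∑ u ∈ Finset.range (v + 1), update N μ v b u)
            (∑ u ∈ Finset.Ico (v + 1) N, update N μ v b u) /
              ∑ u ∈ Finset.Ico (v + 1) N, update N μ v b u)) ∧
        (x < v + 1 → c₂ ≤ (1 - 2 * p (v + 1)) *
          (min (∑ u ∈ Finset.range (v + 1), update N μ v b u)
            (∑ u ∈ Finset.Ico (v + 1) N, update N μ v b u) /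
              ∑ u ∈ Finset.range (v + 1), update N μ v b u)) by
    obtain ⟨c₁, c₂, hc₁, hc₂, hcc, hge, hlt, H⟩ := H
    have hA : 0 ≤ (1 - c₂ / 40) / (1 - 1 / 1600) := div_nonneg (by linarith) (by norm_num)
    calc _ ≤ expect (orc v) fun b => ENNReal.ofReal ((1 - c₂ / 40) / (1 - 1 / 1600)) *
          ENNReal.ofReal (1 / update N μ v b x) := by
          refine expect_mono _ fun b => ?_
          rw [← ENNReal.ofReal_mul hA]
          exact expect_inv_update_le (hO.nonneg _) (hO.le_one _) (hO.apply_true _)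
            (hO.apply_false _) (fun v => update_nonneg hμ b v)
            (by linarith [(update_bounds (N := N) (θ := v) hμ b x).1]) (H b).1 (H b).2
      _ ≤ ENNReal.ofReal ((1 - c₂ / 40) / (1 - 1 / 1600)) *
          ENNReal.ofReal ((1 - c₁ / 40) / (1 - 1 / 1600) * (1 / μ x)) := by
          rw [expect_mul_left]
          gcongr
          exact expect_inv_update_le (hO.nonneg _) (hO.le_one _) (hO.apply_true _)
            (hO.apply_false _) hμ hx hge hlt
      _ = _ := by
          rw [← ENNReal.ofReal_mul hA, ← hcc]
          congr 1
          ring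
  have hy := fun θ => min_div_mem (hlo0 μ θ hμ) (hup0 μ θ hμ)
  have hy' := fun b t θ => min_div_mem (hlo0 _ θ fun v => update_nonneg (θ := t) (N := N) hμ b v)
    (hup0 _ θ fun v => update_nonneg (θ := t) (N := N) hμ b v)
  rcases hc with rfl | ⟨hvI, rfl⟩
  · refine ⟨0, 0, by norm_num, by norm_num, by norm_num, fun h => ?_, fun h => ?_,
      fun b => ⟨fun h => ?_, fun h => ?_⟩⟩
    · exact mul_nonneg (by linarith [hO.half_le v h]) (hy v).1.1
    · exact mul_nonneg (by linarith [hO.le_half v h hv.le]) (hy v).2.1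
    · exact mul_nonneg (by linarith [hO.half_le (v + 1) h]) (hy' b v (v + 1)).1.1
    · exact mul_nonneg (by linarith [hO.le_half (v + 1) h hv]) (hy' b v (v + 1)).2.1
  rcases lt_or_gt_of_ne (show v ≠ x from fun h => hvI (h ▸ hO.mem)) with hvx | hvx
  · refine ⟨0, 9 / 50, by norm_num, by norm_num, by norm_num, fun h => ?_, fun h => ?_,
      fun b => ⟨fun h => ?_, fun h => ?_⟩⟩
    · exact mul_nonneg (by linarith [hO.half_le v h]) (hy v).1.1
    · exact mul_nonneg (by linarith [hO.le_half v h hv.le]) (hy v).2.1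
    · have hp := hO.bias_right v hvI hvx
      have hsum' := Finset.sum_range_add_sum_Ico (update N μ v b) (show v + 1 ≤ N from hv)
      rw [sum_update hμ hv.le, hsum] at hsum'
      -- The first update may have unbalanced the halves, but only to 41/80 against 39/80, a ratio
      -- still above 9/10.
      have hle : ∑ u ∈ Finset.Ico (v + 1) N, update N μ v b u ≤ 41 / 40 * (1 / 2) := by
        refine (Finset.sum_le_sum fun u _ => (update_bounds hμ b u).2).trans ?_
        rw [← Finset.mul_sum]
        linarith
      have hpos : 0 < ∑ u ∈ Finset.Ico (v + 1) N, update N μ v b u :=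
        lt_of_lt_of_le (by linarith [(update_bounds (N := N) (θ := v) hμ b x).1])
          (Finset.single_le_sum (fun u _ => update_nonneg (θ := v) (N := N) hμ b u)
            (Finset.mem_Ico.2 ⟨h, hO.lt⟩))
      have : 9 / 10 ≤ min (∑ u ∈ Finset.range (v + 1), update N μ v b u)
            (∑ u ∈ Finset.Ico (v + 1) N, update N μ v b u) /
              ∑ u ∈ Finset.Ico (v + 1) N, update N μ v b u := by
        rw [le_div_iff₀ hpos]
        exact le_min (by linarith) (by linarith)
      nlinarith
    · omega
  · refine ⟨9 / 50, 0, by norm_num, by norm_num, by norm_num, fun h => ?_, fun h => ?_,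
      fun b => ⟨fun h => ?_, fun h => ?_⟩⟩
    · omega
    · have hp := hO.bias_left v hvI hvx hv
      have hsum' := Finset.sum_range_add_sum_Ico μ hv.le
      rw [hsum] at hsum'
      have hpos : 0 < ∑ u ∈ Finset.range v, μ u :=
        lt_of_lt_of_le hx (Finset.single_le_sum (fun u _ => hμ u) (Finset.mem_range.2 hvx))
      have : 9 / 10 ≤ min (∑ u ∈ Finset.range v, μ u)
            (∑ u ∈ Finset.Ico v N, μ u) / ∑ u ∈ Finset.range v, μ u := by
        rw [le_div_iff₀ hpos]
        exact le_min (by linarith) (by linarith)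
      nlinarith
    · omega
    · exact mul_nonneg (by linarith [hO.le_half (v + 1) h hv]) (hy' b v (v + 1)).2.1

/-- The base is the inverse of `1 - (9/50)/40 = 1991/2000`, so counting a wrong median cancels its
gain exactly. The product of this power with the potential then grows by at most `(1 - 1/1600)⁻²`
per step. -/
theorem expect_search_le {N : ℕ} {orc : ℕ → PMF Bool} {p : ℕ → ℝ} {x : ℕ} {I : Set ℕ}
    [DecidablePred (· ∈ I)] (hO : OracleFor N orc p x I) (k : ℕ) {μ : ℕ → ℝ}
    (hμ : ∀ v, 0 ≤ μ v) (hsum : ∑ v ∈ Finset.range N, μ v = 1) (hx : 0 < μ x) (acc : List ℕ) :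
    (expect (search N orc k μ acc) fun acc' =>
      ENNReal.ofReal ((2000 / 1991) ^ acc'.countP fun u => decide (u ∉ I))) ≤
      ENNReal.ofReal ((2000 / 1991) ^ (acc.countP fun u => decide (u ∉ I)) *
        ((1 / (1 - 1 / 1600) ^ 2) ^ k * (1 / μ x))) := by
  induction k generalizing μ acc with
  | zero =>
    rw [search, expect_pure]
    apply ENNReal.ofReal_le_ofReal
    have : μ x ≤ 1 := by
      rw [← hsum]
      exact Finset.single_le_sum (fun u _ => hμ u) (Finset.mem_range.2 hO.lt)
    have : 1 ≤ 1 / μ x := (one_le_div hx).2 this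
    rw [pow_zero, one_mul]
    exact le_mul_of_one_le_right (by positivity) this
  | succ k ih =>
    have hN : 0 < N := by have := hO.lt; omega
    have hv := wmedian_lt hN hμ
    rw [search, expect_bind]
    simp only [expect_bind]
    set v := wmedian N μ
    set A : ℝ := (2000 / 1991) ^ ((v :: acc).countP fun u => decide (u ∉ I)) *
      (1 / (1 - 1 / 1600) ^ 2) ^ k
    have hA : 0 ≤ A := by positivity
    calc _ ≤ expect (orc v) fun b => expect (orc (v + 1)) fun b' => ENNReal.ofReal A *
          ENNReal.ofReal (1 / update N (update N μ v b) (v + 1) b' x) := by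
          refine expect_mono _ fun b => expect_mono _ fun b' => ?_
          rw [← ENNReal.ofReal_mul hA, mul_assoc]
          have h1 : ∀ u, 0 ≤ update N μ v b u := fun u => update_nonneg hμ b u
          refine ih (fun u => update_nonneg h1 b' u) ?_ ?_ _
          · rw [sum_update h1 hv, sum_update hμ hv.le, hsum]
          · have := (update_bounds (N := N) (θ := v) hμ b x).1
            have := (update_bounds (N := N) (θ := v + 1) h1 b' x).1
            linarith
      _ = ENNReal.ofReal A * expect (orc v) fun b => expect (orc (v + 1)) fun b' =>
          ENNReal.ofReal (1 / update N (update N μ v b) (v + 1) b' x) := by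
          simp only [expect_mul_left]
      _ ≤ _ := ?_
    by_cases hvI : v ∈ I
    · refine (mul_le_mul_right (expect_inv_step_le hO hμ hsum hx (Or.inl rfl)) _).trans ?_
      rw [← ENNReal.ofReal_mul hA]
      apply ENNReal.ofReal_le_ofReal
      have e : (v :: acc).countP (fun u => decide (u ∉ I)) =
          acc.countP fun u => decide (u ∉ I) := by
        rw [List.countP_cons_of_neg (by simpa using hvI)]
      simp only [A, e]
      apply le_of_eq
      ring
    · refine (mul_le_mul_right (expect_inv_step_le hO hμ hsum hx
        (Or.inr ⟨hvI, rfl⟩)) _).trans ?_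
      rw [← ENNReal.ofReal_mul hA]
      apply ENNReal.ofReal_le_ofReal
      have e : (v :: acc).countP (fun u => decide (u ∉ I)) =
          (acc.countP fun u => decide (u ∉ I)) + 1 := by
        rw [List.countP_cons_of_pos (by simpa using hvI)]
      simp only [A, e]
      apply le_of_eq
      ring

/-- Markov's inequality: a wrong result forces at least `k` of the `2 * k` medians outside `I`. The
uniform start gives the factor `N`, and `1991/2000 * (1 - 1/1600)⁻⁴ ≤ 999/1000`. -/
theorem expect_search_wrong_le {N : ℕ} {orc : ℕ → PMF Bool} {p : ℕ → ℝ} {x : ℕ} {I : Set ℕ}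
    (hO : OracleFor N orc p x I) (hI : I.OrdConnected) (k : ℕ) :
    expect (search N orc (2 * k) (fun _ => 1 / (N : ℝ)) [])
      ({acc | listMedian N acc ∉ I}.indicator 1) ≤
      ENNReal.ofReal (N * (999 / 1000) ^ k) := by
  classical
  have hN : 0 < N := by have := hO.lt; omega
  have hN' : (0 : ℝ) < N := by exact_mod_cast hN
  have h0 : ∀ v : ℕ, 0 ≤ (fun _ : ℕ => 1 / (N : ℝ)) v := fun _ => by positivity
  have hE := expect_search_le hO (2 * k) h0 (by simp; field_simp) (by simpa using hN') []
  calc _ ≤ expect (search N orc (2 * k) (fun _ => 1 / (N : ℝ)) []) fun acc =>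
        ENNReal.ofReal ((1991 / 2000) ^ k) *
          ENNReal.ofReal ((2000 / 1991) ^ acc.countP fun u => decide (u ∉ I)) := by
        refine expect_mono_support _ fun acc hacc => ?_
        by_cases h : listMedian N acc ∈ I
        · rw [Set.indicator_of_notMem (by simpa using h)]
          exact zero_le
        · rw [Set.indicator_of_mem (by simpa using h), Pi.one_apply,
            ← ENNReal.ofReal_mul (by positivity), ENNReal.one_le_ofReal]
          have hs := search_support hN h0 (fun u hu => by simp at hu) hacc
          have hlen := length_le_of_listMedian_notMem hN hI hO.mem hs.1 h
          rw [hs.2, List.length_nil] at hlen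
          have hk : k ≤ acc.countP fun u => decide (u ∉ I) := by omega
          have := pow_le_pow_right₀ (show (1 : ℝ) ≤ 2000 / 1991 by norm_num) hk
          calc (1 : ℝ) = (1991 / 2000) ^ k * (2000 / 1991) ^ k := by
                rw [← mul_pow]; norm_num
            _ ≤ _ := by gcongr
    _ ≤ _ := by
        rw [expect_mul_left]
        refine (mul_le_mul_right hE _).trans ?_
        rw [← ENNReal.ofReal_mul (by positivity)]
        apply ENNReal.ofReal_le_ofReal
        rw [List.countP_nil, pow_zero, one_mul, one_div_one_div, pow_mul, ← mul_assoc, ← mul_pow,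
          mul_comm]
        gcongr
        norm_num

end NoisySearch

/-! ### The search as a query algorithm. -/

section SearchProgram

variable {w : ℕ}

/-- Implementation of `search` on the concatenation of `r` memories of `cells` words. Every
comparison uses a new block of `s` words of workspace, starting at `off`. -/
noncomputable def searchProg (r cells s : ℕ) (p : Prog w) (N : ℕ) :
    ℕ → ℕ → (ℕ → ℝ) → List ℕ → Prog w
  | 0, _, _, acc => .step (.const 3 (BitVec.ofNat w (listMedian N acc))) (.ret 3)
  | k + 1, off, μ, acc =>
      noisyTestProg r cells s off p (wmedian N μ) fun b =>
        noisyTestProg r cells s (off + s) p (wmedian N μ + 1) fun b' =>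
          searchProg r cells s p N k (off + s + s)
            (update N (update N μ (wmedian N μ) b) (wmedian N μ + 1) b') (wmedian N μ :: acc)

theorem time_searchProg_le (r cells s : ℕ) (p : Prog w) (N k off : ℕ) (μ : ℕ → ℝ)
    (acc : List ℕ) :
    (searchProg r cells s p N k off μ acc).time ≤ k * (2 * (6 * p.time + 15)) + 2 := by
  induction k generalizing off μ acc with
  | zero => simp [searchProg, Prog.time]
  | succ k ih =>
    rw [searchProg]
    refine (time_noisyTestProg_le _ _ _ _ _ _ fun b =>
      time_noisyTestProg_le _ _ _ _ _ _ fun b' => ih _ _ _).trans ?_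
    rw [add_mul]
    omega

/-- Median of the answers of random copies, where `ν j` is the distribution of the answer of the
`j`-th copy, computed by noisy binary search on `{0, …, N - 1}` with `k` steps. -/
noncomputable def robustAnswer {r : ℕ} [NeZero r] (N k : ℕ) (ν : Fin r → PMF (BitVec w)) :
    PMF (BitVec w) :=
  (search N (noisyTest ν) k (fun _ => 1 / (N : ℝ)) []).map fun acc =>
    BitVec.ofNat w (listMedian N acc)

/-- The real weights are functions of the branch reached in the computation tree, so only the
thresholds appear in the program, as constants of at most `N ≤ 2 ^ w`. -/
theorem run_searchProg {r m m' l s tot off : ℕ} [NeZero r] {M : Fin r → Fin m → BitVec w}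
    {Mem : Fin m' → BitVec w} {q : Fin l → BitVec w} {W : Fin tot → BitVec w} {p : Prog w}
    {N k : ℕ} {μ : ℕ → ℝ} {acc : List ℕ} (hN : 0 < N) (hNw : N ≤ 2 ^ w) (hμ : ∀ v, 0 ≤ μ v)
    (hr : r ∣ 2 ^ w) (h8 : 8 < 2 ^ w) (hrw : r < 2 ^ w) (hmem : r * m < 2 ^ w)
    (hoff : 6 ≤ off) (htot : off + k * (2 * s) ≤ tot) (htot' : tot < 2 ^ w)
    (hM : ∀ (j : Fin r) (a : ℕ), a < m → readAt Mem (j * m + a) = readAt (M j) a)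
    (h : Fresh off W) :
    (searchProg r m s p N k off μ acc).run Mem q W =
      (search N (noisyTest fun j => p.run (M j) q fun _ : Fin s => 0) k μ acc).map fun acc =>
        BitVec.ofNat w (listMedian N acc) := by
  induction k generalizing off μ acc W with
  | zero =>
    rw [searchProg, search, run_step_const, Prog.run, readAt_writeAt_self _ _ (by omega),
      PMF.pure_map]
  | succ k ih =>
    have hv := wmedian_lt hN hμ
    rw [add_mul, one_mul] at htot
    rw [searchProg, search, PMF.map_bind]
    refine run_noisyTestProg hr h8 hrw hmem hoff (by omega) htot' (by omega) hM
      (fun b W hW => ?_) h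
    rw [PMF.map_bind]
    refine run_noisyTestProg hr h8 hrw hmem (by omega) (by omega) htot' (by omega) hM
      (fun b' W hW => ?_) hW
    exact ih (fun v => update_nonneg (fun v => update_nonneg hμ b v) b' v) (by omega) (by omega)
      hW

theorem readAt_concat {r m : ℕ} (f : Fin r → Fin m → BitVec w) (j : Fin r) {a : ℕ}
    (ha : a < m) :
    readAt (fun i : Fin (r * m) => f i.divNat i.modNat) (j * m + a) = readAt (f j) a := by
  have hlt : j * m + a < r * m := by
    calc (j : ℕ) * m + a < j * m + m := by omega
      _ = (j + 1) * m := by ring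
      _ ≤ r * m := Nat.mul_le_mul_right m j.2
  unfold readAt
  rw [dif_pos hlt, dif_pos ha]
  have h1 : (⟨j * m + a, hlt⟩ : Fin (r * m)).divNat = j := by
    apply Fin.ext
    rw [Fin.coe_divNat]
    change (j * m + a) / m = j
    rw [mul_comm, Nat.mul_add_div (by omega), Nat.div_eq_of_lt ha, add_zero]
  have h2 : (⟨j * m + a, hlt⟩ : Fin (r * m)).modNat = ⟨a, ha⟩ := by
    apply Fin.ext
    rw [Fin.coe_modNat]
    change (j * m + a) % m = a
    rw [mul_comm, Nat.mul_add_mod, Nat.mod_eq_of_lt ha]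
  change f (Fin.divNat ⟨j * m + a, hlt⟩) (Fin.modNat ⟨j * m + a, hlt⟩) = _
  rw [h1, h2]

variable {X : Type*}

theorem answer_ofCopies (D : DataStructure X w) {r l N k : ℕ} [NeZero r] (hN : 0 < N)
    (hNw : N ≤ 2 ^ w) (hr : r ∣ 2 ^ w) (h8 : 8 < 2 ^ w) (hrw : r < 2 ^ w)
    (hmem : r * D.cells < 2 ^ w) (hwork : 6 + k * (2 * D.work) < 2 ^ w)
    (f : Fin r → Fin D.cells → BitVec w) (q : Fin l → BitVec w) :
    (D.ofCopies r (6 + k * (2 * D.work))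
      (searchProg r D.cells D.work D.prog N k 6 (fun _ => 1 / (N : ℝ)) [])).answer
        (fun i => f i.divNat i.modNat) q = robustAnswer N k fun j => D.answer (f j) q :=
  run_searchProg hN hNw (fun _ => by positivity) hr h8 hrw hmem le_rfl le_rfl hwork
    (fun j _ ha => readAt_concat f j ha) ⟨readAt_zero _, fun _ _ => readAt_zero _⟩

end SearchProgram

/-! ### Insensitivity of the answers to a block of copies. -/

section Stability

variable {w : ℕ}

/-- Probability of a set, as a real number. -/
noncomputable def prob {α : Type*} (P : PMF α) (s : Set α) : ℝ :=
  (expect P (s.indicator 1)).toReal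

section Prob

variable {α : Type*} (P : PMF α)

theorem expect_indicator_le_one (s : Set α) : expect P (s.indicator 1) ≤ 1 :=
  expect_le_of_le P fun a => by
    by_cases h : a ∈ s <;> simp [h]

theorem ofReal_prob (s : Set α) : ENNReal.ofReal (prob P s) = expect P (s.indicator 1) :=
  ENNReal.ofReal_toReal ((expect_indicator_le_one P s).trans_lt ENNReal.one_lt_top).ne

theorem prob_nonneg (s : Set α) : 0 ≤ prob P s := ENNReal.toReal_nonneg

theorem prob_le_one (s : Set α) : prob P s ≤ 1 :=
  ENNReal.toReal_le_of_le_ofReal zero_le_one (by simpa using expect_indicator_le_one P s)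

theorem prob_mono {s t : Set α} (h : s ⊆ t) : prob P s ≤ prob P t := by
  refine ENNReal.toReal_mono ((expect_indicator_le_one P t).trans_lt ENNReal.one_lt_top).ne ?_
  exact expect_mono P fun a => Set.indicator_le_indicator_of_subset h (fun _ => zero_le) a

theorem prob_compl (s : Set α) : prob P sᶜ = 1 - prob P s := by
  have h : expect P (s.indicator 1) + expect P (sᶜ.indicator 1) = 1 := by
    rw [← expect_add, ← expect_const P 1]
    congr 1
    ext a
    by_cases h : a ∈ s <;> simp [h]
  rw [← ofReal_prob, ← ofReal_prob, ← ENNReal.ofReal_add (prob_nonneg P s) (prob_nonneg P _),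
    ENNReal.ofReal_eq_one] at h
  linarith

end Prob

variable {r : ℕ}

/-- Average over the copies of the probability of a set of answers. -/
noncomputable def copyAvg (ν : Fin r → PMF (BitVec w)) (s : Set (BitVec w)) : ℝ :=
  (r : ℝ)⁻¹ * ∑ j, prob (ν j) s

theorem copyAvg_nonneg (ν : Fin r → PMF (BitVec w)) (s : Set (BitVec w)) : 0 ≤ copyAvg ν s :=
  mul_nonneg (by positivity) (Finset.sum_nonneg fun _ _ => prob_nonneg _ _)

theorem copyAvg_mono (ν : Fin r → PMF (BitVec w)) {s t : Set (BitVec w)} (h : s ⊆ t) :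
    copyAvg ν s ≤ copyAvg ν t :=
  mul_le_mul_of_nonneg_left (Finset.sum_le_sum fun _ _ => prob_mono _ h) (by positivity)

theorem copyAvg_compl [NeZero r] (ν : Fin r → PMF (BitVec w)) (s : Set (BitVec w)) :
    copyAvg ν sᶜ = 1 - copyAvg ν s := by
  have hr : (r : ℝ) ≠ 0 := by exact_mod_cast NeZero.ne r
  unfold copyAvg
  simp only [prob_compl, Finset.sum_sub_distrib]
  simp
  field_simp

theorem copyAvg_le_one [NeZero r] (ν : Fin r → PMF (BitVec w)) (s : Set (BitVec w)) :
    copyAvg ν s ≤ 1 := by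
  have := copyAvg_compl ν s
  have := copyAvg_nonneg ν sᶜ
  linarith

theorem noisyTest_apply_true [NeZero r] (ν : Fin r → PMF (BitVec w)) (θ : ℕ) :
    noisyTest ν θ true =
      ENNReal.ofReal (1 / 8 + 3 / 4 * copyAvg ν {a | θ ≤ a.toNat}) := by
  have hr : (0 : ℝ) < r := by exact_mod_cast Nat.pos_of_ne_zero (NeZero.ne r)
  have hcopy : (expect ((PMF.uniformOfFintype (Fin r)).bind fun j =>
      (ν j).map fun a => decide (θ ≤ a.toNat)) fun b => if b = true then 1 else 0) =
      ENNReal.ofReal (copyAvg ν {a | θ ≤ a.toNat}) := by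
    rw [expect_bind, expect_uniform, copyAvg, ENNReal.ofReal_mul (by positivity),
      ENNReal.ofReal_sum_of_nonneg (fun _ _ => prob_nonneg _ _), ENNReal.ofReal_inv_of_pos hr,
      Fintype.card_fin, ENNReal.ofReal_natCast]
    congr 1
    refine Finset.sum_congr rfl fun j _ => ?_
    rw [expect_map, ofReal_prob]
    congr 1
    ext a
    by_cases h : θ ≤ a.toNat <;> simp [h]
  have hA := copyAvg_nonneg ν {a | θ ≤ a.toNat}
  rw [apply_eq_expect, noisyTest, expect_bind, expect_uniform]
  have e : ∀ u : Fin 8, (expect (if u = 0 then PMF.pure false else if u = 1 then PMF.pure true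
      else (PMF.uniformOfFintype (Fin r)).bind fun j => (ν j).map fun a =>
        decide (θ ≤ a.toNat)) fun b => if b = true then 1 else 0) =
      ENNReal.ofReal (if u = 0 then 0 else if u = 1 then 1 else
        copyAvg ν {a | θ ≤ a.toNat}) := by
    intro u
    split_ifs
    · simp [expect_pure]
    · simp [expect_pure]
    · exact hcopy
  simp only [e]
  rw [← ENNReal.ofReal_sum_of_nonneg (fun u _ => by split_ifs <;> positivity),
    Fintype.card_fin]
  rw [show ((8 : ℕ) : ℝ≥0∞)⁻¹ = ENNReal.ofReal (1 / 8) by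
    rw [one_div, ENNReal.ofReal_inv_of_pos (by norm_num)]; simp,
    ← ENNReal.ofReal_mul (by norm_num)]
  congr 1
  rw [Fin.sum_univ_eight]
  simp
  ring

theorem apply_false_of_apply_true {P : PMF Bool} {p : ℝ} (hp : 0 ≤ p)
    (h : P true = ENNReal.ofReal p) : P false = ENNReal.ofReal (1 - p) := by
  have h1 := P.tsum_coe
  rw [tsum_fintype, Fintype.sum_bool, h] at h1
  rw [ENNReal.ofReal_sub _ hp, ENNReal.ofReal_one, ← h1, ENNReal.add_sub_cancel_left]
  simp

/-- The averages over the copies differ by at most `B.card / r`. The coin scales this by 3/4, which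
is the `9/16` in `ChiSqLE.of_bool`, and keeps the probabilities in `[1/8, 7/8]`. -/
theorem ChiSqLE.noisyTest [NeZero r] {ν ν' : Fin r → PMF (BitVec w)} {B : Finset (Fin r)}
    (h : ∀ j ∉ B, ν j = ν' j) (θ : ℕ) :
    ChiSqLE (ENNReal.ofReal (1 + 6 * ((B.card : ℝ) / r) ^ 2)) (noisyTest ν θ)
      (noisyTest ν' θ) := by
  have hA := copyAvg_nonneg ν {a | θ ≤ a.toNat}
  have hA' := copyAvg_nonneg ν' {a | θ ≤ a.toNat}
  have hB := copyAvg_le_one ν {a | θ ≤ a.toNat}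
  have hB' := copyAvg_le_one ν' {a | θ ≤ a.toNat}
  have hr : (0 : ℝ) < r := by exact_mod_cast Nat.pos_of_ne_zero (NeZero.ne r)
  have hdiff : |copyAvg ν {a | θ ≤ a.toNat} - copyAvg ν' {a | θ ≤ a.toNat}| ≤
      (B.card : ℝ) / r := by
    rw [copyAvg, copyAvg, ← mul_sub, ← Finset.sum_sub_distrib, abs_mul, abs_of_pos (by positivity),
      inv_mul_eq_div]
    gcongr
    calc _ ≤ ∑ j, |prob (ν j) {a | θ ≤ a.toNat} - prob (ν' j) {a | θ ≤ a.toNat}| :=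
          Finset.abs_sum_le_sum_abs _ _
      _ = ∑ j ∈ B, |prob (ν j) {a | θ ≤ a.toNat} - prob (ν' j) {a | θ ≤ a.toNat}| := by
          symm
          apply Finset.sum_subset (Finset.subset_univ _)
          intro j _ hj
          rw [h j hj, sub_self, abs_zero]
      _ ≤ ∑ j ∈ B, 1 := by
          refine Finset.sum_le_sum fun j _ => ?_
          rw [abs_le]
          constructor <;> linarith [prob_nonneg (ν j) {a | θ ≤ a.toNat},
            prob_nonneg (ν' j) {a | θ ≤ a.toNat}, prob_le_one (ν j) {a | θ ≤ a.toNat},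
            prob_le_one (ν' j) {a | θ ≤ a.toNat}]
      _ = _ := by simp
  refine ChiSqLE.of_bool (noisyTest_apply_true ν θ)
    (apply_false_of_apply_true (by positivity) (noisyTest_apply_true ν θ)) (by positivity)
    (by linarith) (noisyTest_apply_true ν' θ)
    (apply_false_of_apply_true (by positivity) (noisyTest_apply_true ν' θ)) (by linarith)
    (by linarith) ?_
  have := sq_le_sq' (neg_le_of_abs_le hdiff) (le_of_abs_le hdiff)
  nlinarith

theorem ChiSqLE.search {K : ℝ≥0∞} {orc orc' : ℕ → PMF Bool} (h : ∀ θ, ChiSqLE K (orc θ) (orc' θ))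
    (N k : ℕ) (μ : ℕ → ℝ) (acc : List ℕ) :
    ChiSqLE (K ^ (2 * k)) (search N orc k μ acc) (search N orc' k μ acc) := by
  induction k generalizing μ acc with
  | zero =>
    rw [mul_zero, pow_zero]
    exact ChiSqLE.refl _
  | succ k ih =>
    rw [show K ^ (2 * (k + 1)) = K * (K * K ^ (2 * k)) by ring]
    exact (h _).bind fun b => (h _).bind fun b' => ih _ _

theorem ChiSqLE.robustAnswer [NeZero r] {ν ν' : Fin r → PMF (BitVec w)} {B : Finset (Fin r)}
    (h : ∀ j ∉ B, ν j = ν' j) (N k : ℕ) :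
    ChiSqLE (ENNReal.ofReal (1 + 6 * ((B.card : ℝ) / r) ^ 2) ^ (2 * k)) (robustAnswer N k ν)
      (robustAnswer N k ν') :=
  (ChiSqLE.search (ChiSqLE.noisyTest h) N k _ _).map _

end Stability

/-! ### Correctness of the search when most copies are right on average. -/

section Accuracy

variable {w r : ℕ}

/-- The centre is a median of the averaged answer distribution; it lies in the convex set `I`
because `I` has mass above 1/2. The biases come from `1/8 + 3/4 * 13/20 ≥ 3/5` and `1/8 + 3/4 * 7/20
≤ 2/5`. -/
theorem exists_oracleFor [NeZero r] {ν : Fin r → PMF (BitVec w)} {N : ℕ} {I : Set ℕ}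
    (hI : I.OrdConnected) (hIN : I ⊆ Set.Iio N)
    (hν : 13 / 20 ≤ copyAvg ν {a | a.toNat ∈ I}) :
    ∃ x, OracleFor N (noisyTest ν)
      (fun θ => 1 / 8 + 3 / 4 * copyAvg ν {a | θ ≤ a.toNat}) x I := by
  classical
  have h0 : 1 / 2 ≤ copyAvg ν {a | 0 ≤ a.toNat} := by
    have : {a : BitVec w | 0 ≤ a.toNat} = ∅ᶜ := by ext; simp
    rw [this, copyAvg_compl]
    have : copyAvg ν ∅ = 0 := by simp [copyAvg, prob, expect]
    linarith
  have hanti : ∀ {θ θ' : ℕ}, θ ≤ θ' →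
      copyAvg ν {a | θ' ≤ a.toNat} ≤ copyAvg ν {a | θ ≤ a.toNat} :=
    fun h => copyAvg_mono ν fun a ha => h.trans ha
  have hright : ∀ θ, (∀ u ∈ I, θ ≤ u) → 13 / 20 ≤ copyAvg ν {a | θ ≤ a.toNat} :=
    fun θ h => hν.trans (copyAvg_mono ν fun a ha => h _ ha)
  have hleft : ∀ θ, (∀ u ∈ I, u < θ) → copyAvg ν {a | θ ≤ a.toNat} ≤ 7 / 20 := by
    intro θ h
    have h1 : copyAvg ν {a | θ ≤ a.toNat} ≤ copyAvg ν {a | a.toNat ∈ I}ᶜ :=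
      copyAvg_mono ν fun a (ha : θ ≤ a.toNat) hI => absurd (h _ hI) (by omega)
    rw [copyAvg_compl] at h1
    linarith
  set x := Nat.findGreatest (fun θ => 1 / 2 ≤ copyAvg ν {a | θ ≤ a.toNat}) N with hx
  have hx1 : 1 / 2 ≤ copyAvg ν {a | x ≤ a.toNat} :=
    Nat.findGreatest_spec (P := fun θ => 1 / 2 ≤ copyAvg ν {a | θ ≤ a.toNat}) (Nat.zero_le N) h0
  have hx2 : ∀ θ, x < θ → θ ≤ N → copyAvg ν {a | θ ≤ a.toNat} < 1 / 2 :=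
    fun θ h h' => not_le.1 (Nat.findGreatest_is_greatest h h')
  obtain ⟨u, huI, hux⟩ : ∃ u ∈ I, x ≤ u := by
    by_contra! h
    linarith [hleft x h]
  obtain ⟨u', huI', hux'⟩ : ∃ u ∈ I, u ≤ x := by
    by_contra! h
    have := hIN huI
    rw [Set.mem_Iio] at this
    have := h u huI
    linarith [hx2 (x + 1) (by omega) (by omega), hright (x + 1) h]
  have hxI : x ∈ I := hI.out huI' huI ⟨hux', hux⟩
  refine ⟨x, fun θ => ?_, fun θ => ?_, noisyTest_apply_true ν, fun θ => ?_, fun θ h => ?_,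
    fun θ h h' => ?_, fun v hv h => ?_, fun v hv h h' => ?_, hIN hxI, hxI⟩
  · linarith [copyAvg_nonneg ν {a | θ ≤ a.toNat}]
  · linarith [copyAvg_le_one ν {a | θ ≤ a.toNat}]
  · exact apply_false_of_apply_true (by linarith [copyAvg_nonneg ν {a | θ ≤ a.toNat}])
      (noisyTest_apply_true ν θ)
  · linarith [hanti h]
  · linarith [hx2 θ h h']
  · have := hright (v + 1) fun u hu => by
      by_contra! hlt
      exact hv (hI.out hu hxI ⟨by omega, h.le⟩)
    linarith
  · have := hleft v fun u hu => by
      by_contra! hlt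
      exact hv (hI.out hxI hu ⟨h.le, hlt⟩)
    linarith

theorem expect_robustAnswer_wrong_le [NeZero r] {ν : Fin r → PMF (BitVec w)} {N : ℕ} {V : Set ℕ}
    (hV : V.OrdConnected) (hVN : ∀ v ∈ V, v < 2 ^ w → v < N)
    (hν : 13 / 20 ≤ copyAvg ν {a | a.toNat ∈ V}) (k : ℕ) :
    expect (robustAnswer N (2 * k) ν) ({b | b.toNat ∉ V}.indicator 1) ≤
      ENNReal.ofReal (N * (999 / 1000) ^ k) := by
  -- Correct answers that do not fit into a word are discarded; they carry no mass, and the output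
  -- is then not truncated.
  have hI : (V ∩ Set.Iio (2 ^ w)).OrdConnected := hV.inter Set.ordConnected_Iio
  obtain ⟨x, hx⟩ := exists_oracleFor (ν := ν) (N := N) hI (fun v hv => hVN v hv.1 hv.2) (by
    convert hν using 3
    ext a
    simp [a.isLt])
  rw [robustAnswer, expect_map]
  refine (expect_mono _ fun acc => ?_).trans (expect_search_wrong_le hx hI k)
  by_cases h : listMedian N acc ∈ V ∩ Set.Iio (2 ^ w)
  · rw [Set.indicator_of_notMem]
    · exact zero_le
    · rw [Set.mem_ofPred_eq, not_not, BitVec.toNat_ofNat, Nat.mod_eq_of_lt h.2]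
      exact h.1
  · rw [Set.indicator_of_mem (s := {acc | listMedian N acc ∉ V ∩ Set.Iio (2 ^ w)}) h]
    exact Set.indicator_le_self' (fun _ _ => zero_le) _

end Accuracy

/-! ### The adaptive game for an abstract answering mechanism. -/

section Play

variable {w : ℕ} {Y : Type*}

/-- `t` rounds of the game between an adversary and a mechanism that answers the query `q` with a
fresh sample from `ans q`. -/
noncomputable def playWith (ans : Y → PMF (BitVec w)) (A : List (Y × BitVec w) → PMF Y) :
    ℕ → List (Y × BitVec w) → PMF (List (Y × BitVec w))
  | 0, h => PMF.pure h
  | t + 1, h => (A h).bind fun q => (ans q).bind fun b => playWith ans A t ((q, b) :: h)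

theorem play_eq_playWith {X : Type*} (D : DataStructure X w) {l : ℕ}
    (M : Fin D.cells → BitVec w) (A : Adversary w l) (t : ℕ)
    (h : List ((Fin l → BitVec w) × BitVec w)) :
    D.play M A t h = playWith (D.answer M) A t h := by
  induction t generalizing h with
  | zero => rfl
  | succ t ih => simp only [DataStructure.play, playWith, ih]

variable {A : List (Y × BitVec w) → PMF Y}

/-- The adversary's move has the same law in both games and contributes the factor 1; only the
answers contribute `K`. -/
theorem ChiSqLE.playWith {K : ℝ≥0∞} {ans ans' : Y → PMF (BitVec w)}
    (h : ∀ q, ChiSqLE K (ans q) (ans' q)) (t : ℕ) (g : List (Y × BitVec w)) :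
    ChiSqLE (K ^ t) (playWith ans A t g) (playWith ans' A t g) := by
  induction t generalizing g with
  | zero =>
    rw [pow_zero]
    exact ChiSqLE.refl _
  | succ t ih =>
    rw [pow_succ', ← one_mul (K * K ^ t)]
    exact (ChiSqLE.refl _).bind fun q => (h q).bind fun b => ih _

theorem expect_playWith_sum_le {ans : Y → PMF (BitVec w)} {f : Y → BitVec w → ℝ≥0∞} {η : ℝ≥0∞}
    (h : ∀ q, expect (ans q) (f q) ≤ η) (t : ℕ) (g : List (Y × BitVec w)) :
    (expect (playWith ans A t g) fun g' => (g'.map fun qb => f qb.1 qb.2).sum) ≤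
      (g.map fun qb => f qb.1 qb.2).sum + t * η := by
  induction t generalizing g with
  | zero => simp [playWith, expect_pure]
  | succ t ih =>
    rw [playWith, expect_bind]
    refine expect_le_of_le _ fun q => ?_
    rw [expect_bind]
    refine (expect_mono _ fun b => ih _).trans ?_
    simp only [List.map_cons, List.sum_cons, add_assoc, expect_add, expect_const]
    refine (add_le_add_left (h q) _).trans (le_of_eq ?_)
    push_cast
    ring

theorem expect_list_sum {α β : Type*} (P : PMF α) (F : β → α → ℝ≥0∞) (g : List β) :
    (expect P fun a => (g.map fun x => F x a).sum) = (g.map fun x => expect P (F x)).sum := by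
  induction g with
  | nil => simp [expect_const]
  | cons x g ih => simp only [List.map_cons, List.sum_cons, expect_add, ih]

theorem indicator_exists_le_sum {β : Type*} (p : β → Prop) (g : List β) :
    {g : List β | ∃ x ∈ g, p x}.indicator 1 g ≤
      (g.map fun x => {x | p x}.indicator (1 : β → ℝ≥0∞) x).sum := by
  by_cases h : ∃ x ∈ g, p x
  · rw [Set.indicator_of_mem (s := {g : List β | ∃ x ∈ g, p x}) h, Pi.one_apply]
    obtain ⟨x, hx, hp⟩ := h
    have h1 : (1 : ℝ≥0∞) = {x | p x}.indicator (1 : β → ℝ≥0∞) x := by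
      rw [Set.indicator_of_mem (s := {x | p x}) hp, Pi.one_apply]
    rw [h1]
    exact List.single_le_sum (by simp) _ (List.mem_map.2 ⟨x, hx, rfl⟩)
  · rw [Set.indicator_of_notMem (s := {g : List β | ∃ x ∈ g, p x}) h]
    exact zero_le

end Play

/-! ### Independent copies and resampling. -/

section Independence

variable {α : Type*} (P : PMF α)

theorem expect_comm {β : Type*} (P' : PMF β) (F : α → β → ℝ≥0∞) :
    (expect P fun a => expect P' fun b => F a b) = expect P' fun b => expect P fun a => F a b := by
  unfold expect
  simp only [← ENNReal.tsum_mul_left]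
  rw [ENNReal.tsum_comm]
  exact tsum_congr fun b => tsum_congr fun a => by ring

theorem expect_iid_succ (r : ℕ) (F : (Fin (r + 1) → α) → ℝ≥0∞) :
    expect (iid P (r + 1)) F = expect P fun y => expect (iid P r) fun f => F (Fin.cons y f) := by
  rw [iid, expect_bind]
  simp only [expect_map]

theorem expect_iid_prod (r : ℕ) (F : Fin r → α → ℝ≥0∞) :
    (expect (iid P r) fun f => ∏ j, F j (f j)) = ∏ j, expect P (F j) := by
  induction r with
  | zero => simp [expect_const]
  | succ r ih =>
    rw [expect_iid_succ, Fin.prod_univ_succ, ← ih fun j => F j.succ, mul_comm, ← expect_mul_left]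
    congr 1
    ext y
    simp only [Fin.prod_univ_succ, Fin.cons_zero, Fin.cons_succ, expect_mul_left]
    ring

-- By independence, drawing the coordinates in `B` afresh preserves the law. This decouples the
-- block being judged from the transcript.
open Classical in
theorem expect_iid_resample (r : ℕ) (B : Set (Fin r)) (F : (Fin r → α) → ℝ≥0∞) :
    expect (iid P r) F = expect (iid P r) fun f => expect (iid P r) fun f' =>
      F fun j => if j ∈ B then f' j else f j := by
  induction r with
  | zero =>
    have : ∀ f f' : Fin 0 → α, (fun j => if j ∈ B then f' j else f j) = f :=
      fun f f' => Subsingleton.elim _ _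
    simp only [this, expect_const]
  | succ r ih =>
    have hcons : ∀ (y y' : α) (f f' : Fin r → α),
        (fun j => if j ∈ B then (Fin.cons y' f' : Fin (r + 1) → α) j
          else (Fin.cons y f : Fin (r + 1) → α) j) =
        Fin.cons (if 0 ∈ B then y' else y)
          (fun j => if j ∈ {j : Fin r | j.succ ∈ B} then f' j else f j) := by
      intro y y' f f'
      ext j
      refine Fin.cases ?_ (fun j => ?_) j
      · simp
      · simp
    simp only [expect_iid_succ, hcons]
    by_cases h0 : 0 ∈ B
    · simp only [h0, if_true, expect_const]
      rw [expect_comm (iid P r) P]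
      congr 1
      ext y
      exact ih _ _
    · simp only [h0, if_false, expect_const]
      congr 1
      ext y
      exact ih _ _

end Independence

/-! ### Chernoff bound for the error of a block. -/

section Concentration

variable {α : Type*} {P : PMF α} {f : α → ℝ}

/-- Use `exp y ≤ 1 + y + y²` with `y² ≤ 1/400`: the constant terms are `1 - 7/400 + 1/400 =
197/200`, and the mean adds at most `1/80`. -/
theorem expect_exp_le (h0 : ∀ a, 0 ≤ f a) (h1 : ∀ a, f a ≤ 1)
    (hf : (expect P fun a => ENNReal.ofReal (f a)) ≤ ENNReal.ofReal (1 / 4)) :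
    (expect P fun a => ENNReal.ofReal (Real.exp (1 / 20 * (f a - 7 / 20)))) ≤
      ENNReal.ofReal (399 / 400) := by
  calc _ ≤ expect P fun a => ENNReal.ofReal (197 / 200) +
        ENNReal.ofReal (1 / 20) * ENNReal.ofReal (f a) := by
        refine expect_mono _ fun a => ?_
        rw [← ENNReal.ofReal_mul (by norm_num), ← ENNReal.ofReal_add (by norm_num)
          (mul_nonneg (by norm_num) (h0 a))]
        apply ENNReal.ofReal_le_ofReal
        have := h0 a
        have := h1 a
        have hx : |1 / 20 * (f a - 7 / 20)| ≤ 1 / 20 := by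
          rw [abs_le]; constructor <;> linarith
        have h2 := (abs_le.1 (Real.abs_exp_sub_one_sub_id_le (hx.trans (by norm_num)))).2
        have h3 := sq_le_sq' (by linarith [(abs_le.1 hx).1]) (abs_le.1 hx).2
        linarith
    _ ≤ ENNReal.ofReal (197 / 200) + ENNReal.ofReal (1 / 20) * ENNReal.ofReal (1 / 4) := by
        rw [expect_add, expect_const, expect_mul_left]
        gcongr
    _ = _ := by
        rw [← ENNReal.ofReal_mul (by norm_num), ← ENNReal.ofReal_add (by norm_num) (by norm_num)]
        norm_num

theorem expect_iid_block_le {r : ℕ} (B : Finset (Fin r)) (h0 : ∀ a, 0 ≤ f a)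
    (h1 : ∀ a, f a ≤ 1)
    (hf : (expect P fun a => ENNReal.ofReal (f a)) ≤ ENNReal.ofReal (1 / 4)) :
    expect (iid P r) ({M | 7 / 20 * (B.card : ℝ) < ∑ j ∈ B, f (M j)}.indicator 1) ≤
      ENNReal.ofReal (399 / 400) ^ B.card := by
  calc _ ≤ expect (iid P r) fun M => ∏ j, if j ∈ B then
        ENNReal.ofReal (Real.exp (1 / 20 * (f (M j) - 7 / 20))) else 1 := by
        refine expect_mono _ fun M => ?_
        by_cases h : 7 / 20 * (B.card : ℝ) < ∑ j ∈ B, f (M j)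
        · rw [Set.indicator_of_mem (by exact h), Pi.one_apply, Finset.prod_ite_mem,
            Finset.univ_inter, ← ENNReal.ofReal_prod_of_nonneg fun _ _ => (Real.exp_pos _).le,
            ← Real.exp_sum, ENNReal.one_le_ofReal, Real.one_le_exp_iff, ← Finset.mul_sum,
            Finset.sum_sub_distrib, Finset.sum_const, nsmul_eq_mul]
          linarith
        · rw [Set.indicator_of_notMem (by exact h)]
          exact zero_le
    _ = ∏ j, expect P fun a => if j ∈ B then
        ENNReal.ofReal (Real.exp (1 / 20 * (f a - 7 / 20))) else 1 :=
        expect_iid_prod P r fun j a => if j ∈ B then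
          ENNReal.ofReal (Real.exp (1 / 20 * (f a - 7 / 20))) else 1
    _ = ∏ j, if j ∈ B then (expect P fun a =>
        ENNReal.ofReal (Real.exp (1 / 20 * (f a - 7 / 20)))) else 1 := by
        refine Finset.prod_congr rfl fun j _ => ?_
        split_ifs
        · rfl
        · exact expect_const P 1
    _ ≤ _ := by
        rw [Finset.prod_ite_mem, Finset.univ_inter, Finset.prod_const]
        gcongr
        exact expect_exp_le h0 h1 hf

end Concentration

/-! ### Failure probability of the adaptive game. -/

section Game

variable {w : ℕ} {Y α : Type*} {P : PMF α} {a : α → Y → PMF (BitVec w)} {V : Y → Set ℕ}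

/-- Probability that a copy with memory `m` answers `q` incorrectly. -/
noncomputable def errorProb (a : α → Y → PMF (BitVec w)) (V : Y → Set ℕ) (q : Y) (m : α) : ℝ :=
  prob (a m q) {b | b.toNat ∈ V q}ᶜ

theorem expect_errorProb_le {q : Y}
    (hq : 3 / 4 ≤ (P.bind fun m => a m q).toOuterMeasure {b | b.toNat ∈ V q}) :
    (expect P fun m => ENNReal.ofReal (errorProb a V q m)) ≤ ENNReal.ofReal (1 / 4) := by
  simp only [errorProb, ofReal_prob]
  rw [← expect_bind, ← ofReal_prob, prob_compl]
  rw [← expect_indicator, ← ofReal_prob] at hq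
  apply ENNReal.ofReal_le_ofReal
  have : (3 / 4 : ℝ≥0∞) = ENNReal.ofReal (3 / 4) := by
    rw [ENNReal.ofReal_div_of_pos (by norm_num)]
    simp
  rw [this, ENNReal.ofReal_le_ofReal_iff (prob_nonneg _ _)] at hq
  linarith

-- Compare with the game in which the copies in `B` always answer `0`. Its transcript does not see
-- the memories in `B`, so each asked query is as good as fixed in advance, and a Chernoff bound
-- with a union bound over the `t` rounds applies.
open Classical in
theorem expect_block_bad_sq_le {r N k t : ℕ} [NeZero r] {A : List (Y × BitVec w) → PMF Y}
    (hq : ∀ q, 3 / 4 ≤ (P.bind fun m => a m q).toOuterMeasure {b | b.toNat ∈ V q})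
    (B : Finset (Fin r)) :
    (expect (iid P r) fun M =>
      expect (playWith (fun q => robustAnswer N k fun j => a (M j) q) A t [])
        ({g | ∃ x ∈ g, 7 / 20 * (B.card : ℝ) <
          ∑ j ∈ B, errorProb a V x.1 (M j)}.indicator 1)) ^ 2 ≤
      (ENNReal.ofReal (1 + 6 * ((B.card : ℝ) / r) ^ 2) ^ (2 * k)) ^ t *
        (t * ENNReal.ofReal (399 / 400) ^ B.card) := by
  set ref : (Fin r → α) → Y → PMF (BitVec w) := fun M q =>
    robustAnswer N k fun j => if j ∈ B then PMF.pure 0 else a (M j) q with href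
  set bad : (Fin r → α) → Y × BitVec w → Prop := fun M x => 7 / 20 * (B.card : ℝ) <
          ∑ j ∈ B, errorProb a V x.1 (M j) with hbad
  set K := (ENNReal.ofReal (1 + 6 * ((B.card : ℝ) / r) ^ 2) ^ (2 * k)) ^ t
  have hres : ∀ M M' M'' : Fin r → α, (∀ j ∈ B, M'' j = M' j) → (∀ j ∉ B, M'' j = M j) →
      ref M'' = ref M ∧ bad M'' = bad M' := by
    intro M M' M'' h h'
    constructor
    · ext1 q
      simp only [href]
      congr 1
      ext1 j
      by_cases hj : j ∈ B
      · simp [hj]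
      · simp [hj, h' j hj]
    · ext1 x
      simp only [hbad]
      congr 1
      exact Finset.sum_congr rfl fun j hj => by rw [h j hj]
  -- Indicators equal their squares, so the chi-square bound compares probabilities directly.
  have hsq : ∀ (s : Set (List (Y × BitVec w))) g,
      (s.indicator (1 : List (Y × BitVec w) → ℝ≥0∞) g) ^ 2 = s.indicator 1 g := fun s g => by
    by_cases h : g ∈ s <;> simp [h]
  calc _ ≤ expect (iid P r) fun M => K * expect (playWith (ref M) A t [])
          ({g | ∃ x ∈ g, bad M x}.indicator 1) := by
        refine (expect_sq_le _ _).trans (expect_mono _ fun M => ?_)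
        have h := ChiSqLE.playWith (A := A) (fun q => ChiSqLE.robustAnswer (B := B)
          (ν := fun j => a (M j) q) (ν' := fun j => if j ∈ B then PMF.pure 0 else a (M j) q)
          (fun j hj => by simp [hj]) N k) t [] ({g | ∃ x ∈ g, bad M x}.indicator 1)
        simp only [hsq] at h
        exact h
    _ = K * expect (iid P r) fun M => expect (playWith (ref M) A t [])
          ({g | ∃ x ∈ g, bad M x}.indicator 1) := expect_mul_left _ _ _
    _ ≤ _ := ?_
  gcongr
  calc _ ≤ expect (iid P r) fun M => expect (playWith (ref M) A t []) fun g =>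
          (g.map fun x => {x | bad M x}.indicator (1 : Y × BitVec w → ℝ≥0∞) x).sum :=
        expect_mono _ fun M => expect_mono _ fun g => indicator_exists_le_sum _ g
    _ = expect (iid P r) fun M => expect (iid P r) fun M' =>
          expect (playWith (ref M) A t []) fun g =>
          (g.map fun x => {x | bad M' x}.indicator (1 : Y × BitVec w → ℝ≥0∞) x).sum := by
        -- From here the transcript depends on `M` and the bad event on the independent `M'`.
        rw [expect_iid_resample P r B]
        refine congrArg _ (funext fun M => congrArg _ (funext fun M' => ?_))
        obtain ⟨e1, e2⟩ := hres M M' (fun j => @ite _ (j ∈ (B : Set (Fin r)))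
          (Classical.propDecidable _) (M' j) (M j))
          (fun j hj => if_pos hj) (fun j hj => if_neg hj)
        rw [e1, e2]
    _ = expect (iid P r) fun M => expect (playWith (ref M) A t []) fun g =>
          (g.map fun x => expect (iid P r) fun M' =>
            {x | bad M' x}.indicator (1 : Y × BitVec w → ℝ≥0∞) x).sum := by
        refine congrArg _ (funext fun M => ?_)
        -- Averaging over `M'` for a fixed transcript makes the queries nonadaptive.
        rw [expect_comm]
        refine congrArg _ (funext fun g => ?_)
        exact expect_list_sum _ (fun x M' => {x | bad M' x}.indicator (1 : Y × BitVec w → ℝ≥0∞) x) g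
    _ ≤ expect (iid P r) fun M => expect (playWith (ref M) A t []) fun g =>
          (g.map fun _ => ENNReal.ofReal (399 / 400) ^ B.card).sum := by
        refine expect_mono _ fun M => expect_mono _ fun g => List.sum_le_sum fun x _ => ?_
        exact expect_iid_block_le B (fun m => prob_nonneg _ _) (fun m => prob_le_one _ _)
          (expect_errorProb_le (hq x.1))
    _ ≤ _ := by
        refine expect_le_of_le _ fun M => ?_
        refine (expect_playWith_sum_le (A := A)
          (f := fun _ _ => ENNReal.ofReal (399 / 400) ^ B.card)
          (fun q => (expect_const _ _).le) t []).trans ?_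
        simp

theorem exists_block {n L : ℕ} (e : Fin (n * L) → ℝ)
    (he : 7 / 20 * ((n * L : ℕ) : ℝ) < ∑ j, e j) :
    ∃ i : Fin n, 7 / 20 * (L : ℝ) < ∑ j with j.divNat = i, e j := by
  by_contra! h
  have h1 : ∑ j, e j = ∑ i : Fin n, ∑ j with j.divNat = i, e j :=
    (Finset.sum_fiberwise _ _ _).symm
  have h2 := Finset.sum_le_sum fun i (_ : i ∈ Finset.univ) => h i
  rw [← h1] at h2
  simp at h2 he
  linarith

theorem card_block (n L : ℕ) (i : Fin n) :
    (Finset.univ.filter fun j : Fin (n * L) => j.divNat = i).card = L := by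
  refine Eq.trans ?_ (Finset.card_fin L)
  symm
  refine Finset.card_bij' (fun b _ => finProdFinEquiv (i, b)) (fun j _ => j.modNat) ?_ ?_ ?_ ?_
  · intro b _
    simp only [Finset.mem_filter, Finset.mem_univ, true_and]
    exact congrArg Prod.fst (finProdFinEquiv.symm_apply_apply (i, b))
  · simp
  · intro b _
    exact congrArg Prod.snd (finProdFinEquiv.symm_apply_apply (i, b))
  · intro j hj
    simp only [Finset.mem_filter, Finset.mem_univ, true_and] at hj
    rw [← hj]
    exact finProdFinEquiv.apply_symm_apply j

/-- A wrong response means either that the search failed although the average error was at most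
7/20, or that this average was larger. In the latter case some block exceeds 7/20 as well, by
pigeonhole. -/
theorem expect_game_wrong_le {n L N k t : ℕ} [NeZero (n * L)] {A : List (Y × BitVec w) → PMF Y}
    (hq : ∀ q, 3 / 4 ≤ (P.bind fun m => a m q).toOuterMeasure {b | b.toNat ∈ V q})
    (hV : ∀ q, (V q).OrdConnected) (hVN : ∀ q, ∀ v ∈ V q, v < 2 ^ w → v < N) {y : ℝ≥0∞}
    (hy : (ENNReal.ofReal (1 + 6 * ((L : ℝ) / (n * L : ℕ)) ^ 2) ^ (2 * (2 * k))) ^ t *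
        (t * ENNReal.ofReal (399 / 400) ^ L) ≤ y ^ 2) :
    (expect (iid P (n * L)) fun M =>
      expect (playWith (fun q => robustAnswer N (2 * k) fun j => a (M j) q) A t [])
        ({g | ∃ x ∈ g, x.2.toNat ∉ V x.1}.indicator 1)) ≤
      t * ENNReal.ofReal (N * (999 / 1000) ^ k) + n * y := by
  classical
  set B : Fin n → Finset (Fin (n * L)) := fun i => Finset.univ.filter fun j => j.divNat = i
  have hB : ∀ i, (B i).card = L := card_block n L
  have hr : (0 : ℝ) < (n * L : ℕ) := by exact_mod_cast Nat.pos_of_ne_zero (NeZero.ne (n * L))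
  have hacc : ∀ (M : Fin (n * L) → α) (q : Y),
      ¬ 7 / 20 * ((n * L : ℕ) : ℝ) < ∑ j, errorProb a V q (M j) →
      expect (robustAnswer N (2 * k) fun j => a (M j) q) ({b | b.toNat ∉ V q}.indicator 1) ≤
        ENNReal.ofReal (N * (999 / 1000) ^ k) := by
    intro M q h
    refine expect_robustAnswer_wrong_le (hV q) (hVN q) ?_ k
    have e1 : copyAvg (fun j => a (M j) q) {b | b.toNat ∈ V q}ᶜ =
      ((n * L : ℕ) : ℝ)⁻¹ * ∑ j, errorProb a V q (M j) := rfl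
    have e2 : ((n * L : ℕ) : ℝ)⁻¹ * ∑ j, errorProb a V q (M j) ≤ 7 / 20 := by
      rw [inv_mul_le_iff₀ hr]
      linarith
    rw [← e1, copyAvg_compl] at e2
    linarith
  have hpoint : ∀ (M : Fin (n * L) → α) (g : List (Y × BitVec w)),
      {g : List (Y × BitVec w) | ∃ x ∈ g, x.2.toNat ∉ V x.1}.indicator (1 : List (Y × BitVec w) → ℝ≥0∞) g ≤
      (g.map fun x => {x : Y × BitVec w | x.2.toNat ∉ V x.1 ∧
        ¬ 7 / 20 * ((n * L : ℕ) : ℝ) < ∑ j, errorProb a V x.1 (M j)}.indicator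
          (1 : Y × BitVec w → ℝ≥0∞) x).sum +
      ∑ i, {g : List (Y × BitVec w) | ∃ x ∈ g, 7 / 20 * ((B i).card : ℝ) <
          ∑ j ∈ B i, errorProb a V x.1 (M j)}.indicator (1 : List (Y × BitVec w) → ℝ≥0∞) g := by
    intro M g
    by_cases h : ∃ x ∈ g, x.2.toNat ∉ V x.1
    · obtain ⟨x, hx, hxV⟩ := h
      by_cases hb : 7 / 20 * ((n * L : ℕ) : ℝ) < ∑ j, errorProb a V x.1 (M j)
      · obtain ⟨i, hi⟩ := exists_block _ hb
        have hi : 7 / 20 * ((B i).card : ℝ) < ∑ j ∈ B i, errorProb a V x.1 (M j) := by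
          rw [hB i]
          exact hi
        refine le_add_of_nonneg_of_le zero_le ?_
        refine le_trans ?_ (Finset.single_le_sum (fun _ _ => zero_le) (Finset.mem_univ i))
        rw [Set.indicator_of_mem (s := {g : List (Y × BitVec w) | ∃ x ∈ g,
          7 / 20 * ((B i).card : ℝ) < ∑ j ∈ B i, errorProb a V x.1 (M j)}) ⟨x, hx, hi⟩]
        exact Set.indicator_le_self' (fun _ _ => zero_le) _
      · refine le_add_of_le_of_nonneg ?_ zero_le
        refine le_trans ?_ (indicator_exists_le_sum _ g)
        rw [Set.indicator_of_mem (s := {g : List (Y × BitVec w) | ∃ x ∈ g, x.2.toNat ∉ V x.1 ∧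
          ¬ 7 / 20 * ((n * L : ℕ) : ℝ) < ∑ j, errorProb a V x.1 (M j)}) ⟨x, hx, hxV, hb⟩]
        exact Set.indicator_le_self' (fun _ _ => zero_le) _
    · rw [Set.indicator_of_notMem (s := {g : List (Y × BitVec w) | ∃ x ∈ g, x.2.toNat ∉ V x.1}) h]
      exact zero_le
  refine (expect_mono _ fun M => expect_mono _ fun g => hpoint M g).trans ?_
  simp only [expect_add, expect_finset_sum]
  refine add_le_add ?_ ?_
  · refine expect_le_of_le _ fun M => ?_
    refine (expect_playWith_sum_le (A := A) (f := fun q b => {x : Y × BitVec w |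
      x.2.toNat ∉ V x.1 ∧ ¬ 7 / 20 * ((n * L : ℕ) : ℝ) <
        ∑ j, errorProb a V x.1 (M j)}.indicator (1 : Y × BitVec w → ℝ≥0∞) (q, b))
      (η := ENNReal.ofReal (N * (999 / 1000) ^ k)) (fun q => ?_) t []).trans ?_
    · by_cases hb : 7 / 20 * ((n * L : ℕ) : ℝ) < ∑ j, errorProb a V q (M j)
      · refine expect_le_of_le _ fun b => ?_
        rw [Set.indicator_of_notMem]
        · exact zero_le
        · exact fun h => h.2 hb
      · refine le_trans (expect_mono _ fun b => ?_) (hacc M q hb)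
        by_cases hbV : b.toNat ∈ V q
        · rw [Set.indicator_of_notMem]
          · exact zero_le
          · exact fun h => h.1 hbV
        · rw [Set.indicator_of_mem (s := {b : BitVec w | b.toNat ∉ V q}) hbV]
          exact Set.indicator_le_self' (fun _ _ => zero_le) _
    · simp
  · calc _ ≤ ∑ _i : Fin n, y := by
          refine Finset.sum_le_sum fun i _ => ?_
          have h := expect_block_bad_sq_le (N := N) (k := 2 * k) (t := t) (A := A) hq (B i)
          rw [hB i] at h
          rw [hB i]
          exact (ENNReal.pow_le_pow_left_iff two_ne_zero).1 (h.trans hy)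
      _ = n * y := by simp

end Game

/-! ### Choice of the number and size of blocks and of the search length. -/

section Parameters

/-- In units of `Λ`, `κ` fixes the search length and `l` the block size; `2 ^ e` is the number of
blocks in units of `√Q`, up to rounding. Since `l` is chosen last, it can absorb the union bound
over blocks. -/
theorem exists_parameters (c a : ℕ) : ∃ κ e l : ℕ, (999 / 1000 : ℝ) ^ κ ≤ (1 / 2) ^ (a + c + 2) ∧
    (48 * κ : ℝ) ≤ 2 ^ e ∧ 4 * (399 / 400 : ℝ) ^ l ≤ ((1 / 2) ^ (c + 3) / 2 ^ e) ^ 2 := by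
  obtain ⟨κ, hκ⟩ := exists_pow_lt_of_lt_one (show (0 : ℝ) < (1 / 2) ^ (a + c + 2) by positivity)
    (show (999 / 1000 : ℝ) < 1 by norm_num)
  obtain ⟨l, hl⟩ := exists_pow_lt_of_lt_one
    (show (0 : ℝ) < ((1 / 2) ^ (c + 3) / 2 ^ (48 * κ)) ^ 2 / 4 by positivity)
    (show (399 / 400 : ℝ) < 1 by norm_num)
  refine ⟨κ, 48 * κ, l, hκ.le, ?_, by linarith⟩
  exact_mod_cast (Nat.lt_two_pow_self (n := 48 * κ)).le

/-- By `1 + x ≤ exp x` the exponent is `Λ * 24κQ / (νσ)²`. The assumptions `48κ ≤ ν` and `Q ≤ σ²`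
make the quotient at most `1/2 < log 2`. -/
theorem leakage_le {Λ Q κ n L : ℕ} {ν σ : ℝ} (hL : 0 < L) (hn : (n : ℝ) = ν * σ)
    (hν : 48 * (κ : ℝ) ≤ ν) (hν1 : 1 ≤ ν) (hσ0 : 0 < σ) (hσ : (Q : ℝ) ≤ σ ^ 2) :
    ((1 + 6 * ((L : ℝ) / (n * L : ℕ)) ^ 2) ^ (2 * (2 * (κ * Λ)))) ^ Q ≤ (2 : ℝ) ^ Λ := by
  have hL' : (0 : ℝ) < L := by exact_mod_cast hL
  have hn0 : 0 < ν * σ := by positivity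
  have e1 : (L : ℝ) / (n * L : ℕ) = 1 / (ν * σ) := by
    push_cast
    rw [hn]
    field_simp
  rw [e1, ← pow_mul]
  have h1 : 1 + 6 * (1 / (ν * σ)) ^ 2 ≤ Real.exp (6 * (1 / (ν * σ)) ^ 2) := by
    linarith [Real.add_one_le_exp (6 * (1 / (ν * σ)) ^ 2)]
  calc (1 + 6 * (1 / (ν * σ)) ^ 2) ^ (2 * (2 * (κ * Λ)) * Q)
      ≤ Real.exp (6 * (1 / (ν * σ)) ^ 2) ^ (2 * (2 * (κ * Λ)) * Q) := by gcongr
    _ = Real.exp ((2 * (2 * (κ * Λ)) * Q : ℕ) * (6 * (1 / (ν * σ)) ^ 2)) := by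
        rw [Real.exp_nat_mul]
    _ ≤ Real.exp (Λ * Real.log 2) := by
        apply Real.exp_le_exp.2
        have h2 : (2 * (2 * (κ * Λ)) * Q : ℕ) * (6 * (1 / (ν * σ)) ^ 2) =
            (Λ : ℝ) * (24 * (κ * Q) / (ν * σ) ^ 2) := by
          push_cast
          field_simp
          ring
        rw [h2]
        gcongr
        rw [div_le_iff₀ (by positivity)]
        have h3 : (κ : ℝ) * Q ≤ ν / 48 * σ ^ 2 :=
          mul_le_mul (by linarith) hσ (by positivity) (by positivity)
        have h4 : ν * σ ^ 2 ≤ (ν * σ) ^ 2 := by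
          rw [mul_pow]
          gcongr
          nlinarith
        have := Real.log_two_gt_d9
        nlinarith [sq_nonneg (ν * σ)]
    _ = 2 ^ Λ := by
        rw [Real.exp_nat_mul, Real.exp_log (by norm_num)]

/-- The 4 in `hlz` pays `2 ^ Λ` for the leakage and `2 ^ Λ` for the union over `Q` rounds. -/
theorem bad_sq_le {Λ Q κ n L l : ℕ} {ν σ z : ℝ} (hL : 0 < L) (hn : (n : ℝ) = ν * σ)
    (hν : 48 * (κ : ℝ) ≤ ν) (hν1 : 1 ≤ ν) (hσ0 : 0 < σ) (hσ : (Q : ℝ) ≤ σ ^ 2)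
    (hQ : Q ≤ 2 ^ Λ) (hl : l * Λ ≤ L) (hz : 0 ≤ z) (hlz : 4 * (399 / 400 : ℝ) ^ l ≤ z ^ 2) :
    (ENNReal.ofReal (1 + 6 * ((L : ℝ) / (n * L : ℕ)) ^ 2) ^ (2 * (2 * (κ * Λ)))) ^ Q *
      (Q * ENNReal.ofReal (399 / 400) ^ L) ≤ ENNReal.ofReal (z ^ Λ) ^ 2 := by
  have h0 : 0 ≤ 1 + 6 * ((L : ℝ) / (n * L : ℕ)) ^ 2 := by positivity
  rw [← ENNReal.ofReal_pow h0, ← ENNReal.ofReal_pow (pow_nonneg h0 _),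
    ← ENNReal.ofReal_pow (by norm_num), ← ENNReal.ofReal_natCast,
    ← ENNReal.ofReal_mul (by positivity), ← ENNReal.ofReal_mul (pow_nonneg (pow_nonneg h0 _) _),
    ← ENNReal.ofReal_pow (by positivity)]
  apply ENNReal.ofReal_le_ofReal
  have hQ' : (Q : ℝ) ≤ 2 ^ Λ := by exact_mod_cast hQ
  have hp : (399 / 400 : ℝ) ^ L ≤ ((399 / 400) ^ l) ^ Λ := by
    rw [← pow_mul]
    exact pow_le_pow_of_le_one (by norm_num) (by norm_num) hl
  calc _ ≤ (2 : ℝ) ^ Λ * (2 ^ Λ * ((399 / 400) ^ l) ^ Λ) := by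
        gcongr
        exact leakage_le hL hn hν hν1 hσ0 hσ
    _ = (4 * (399 / 400) ^ l) ^ Λ := by
        rw [← mul_pow, ← mul_pow]
        congr 1
        ring
    _ ≤ (z ^ 2) ^ Λ := by gcongr
    _ = (z ^ Λ) ^ 2 := by rw [← pow_mul, ← pow_mul, mul_comm]

/-- Search failures and bad blocks each get half of the budget; in the second term `ν ^ Λ * 4 ^ Λ`
bounds the number of blocks, which explains the form of `z`. -/
theorem total_failure_le {c a Λ Q κ n N : ℕ} {ν σ z : ℝ} (hΛ : 1 ≤ Λ) (hn : (n : ℝ) = ν * σ)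
    (hν1 : 1 ≤ ν) (hσ0 : 0 < σ) (hσ : σ ≤ 4 ^ Λ) (hQ : Q ≤ 2 ^ Λ) (hN : N ≤ 2 ^ (a * Λ))
    (hκ : (999 / 1000 : ℝ) ^ κ ≤ (1 / 2) ^ (a + c + 2)) (hz : z = (1 / 2) ^ (c + 3) / ν) :
    Q * ENNReal.ofReal (N * (999 / 1000) ^ (κ * Λ)) + n * ENNReal.ofReal (z ^ Λ) ≤
      ENNReal.ofReal ((1 / 2) ^ (c * Λ)) := by
  have hz0 : 0 ≤ z := by rw [hz]; positivity
  rw [← ENNReal.ofReal_natCast, ← ENNReal.ofReal_natCast, ← ENNReal.ofReal_mul (by positivity),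
    ← ENNReal.ofReal_mul (by positivity), ← ENNReal.ofReal_add (by positivity) (by positivity)]
  apply ENNReal.ofReal_le_ofReal
  have hQ' : (Q : ℝ) ≤ 2 ^ Λ := by exact_mod_cast hQ
  have hN' : (N : ℝ) ≤ (2 ^ a) ^ Λ := by
    rw [← pow_mul]
    exact_mod_cast hN
  have hhalf : (1 / 2 : ℝ) ^ Λ ≤ 1 / 2 := by
    calc (1 / 2 : ℝ) ^ Λ ≤ (1 / 2) ^ 1 := pow_le_pow_of_le_one (by norm_num) (by norm_num) hΛ
      _ = _ := pow_one _
  have h1 : (Q : ℝ) * (N * (999 / 1000) ^ (κ * Λ)) ≤ (1 / 2) ^ (c * Λ) * (1 / 2) := by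
    calc (Q : ℝ) * (N * (999 / 1000) ^ (κ * Λ))
        ≤ 2 ^ Λ * ((2 ^ a) ^ Λ * ((1 / 2) ^ (a + c + 2)) ^ Λ) := by
          rw [pow_mul]
          gcongr
      _ = (2 * (2 ^ a * (1 / 2) ^ (a + c + 2))) ^ Λ := by rw [mul_pow, mul_pow]
      _ = ((1 / 2) ^ c * (1 / 2)) ^ Λ := by
          congr 1
          rw [pow_add, pow_add]
          have : (2 : ℝ) ^ a * (1 / 2) ^ a = 1 := by rw [← mul_pow]; norm_num
          linear_combination (1 / 2 : ℝ) ^ c * (1 / 2) * this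
      _ = (1 / 2) ^ (c * Λ) * (1 / 2) ^ Λ := by rw [mul_pow, pow_mul]
      _ ≤ _ := by gcongr
  have h2 : (n : ℝ) * z ^ Λ ≤ (1 / 2) ^ (c * Λ) * (1 / 2) := by
    have hνΛ : ν ≤ ν ^ Λ := le_self_pow₀ hν1 (by omega)
    calc (n : ℝ) * z ^ Λ ≤ (ν ^ Λ * 4 ^ Λ) * z ^ Λ := by
          rw [hn]
          gcongr
      _ = ((1 / 2) ^ c * (1 / 2)) ^ Λ := by
          rw [← mul_pow, ← mul_pow, hz]
          congr 1
          have : ν ≠ 0 := by linarith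
          rw [pow_add]
          field_simp
          norm_num
      _ = (1 / 2) ^ (c * Λ) * (1 / 2) ^ Λ := by rw [mul_pow, pow_mul]
      _ ≤ _ := by gcongr
  linarith

theorem two_pow_clog_le {x : ℕ} (hx : 1 ≤ x) : 2 ^ Nat.clog 2 x ≤ 2 * x := by
  rcases hx.eq_or_lt with rfl | hx
  · simp
  · have h1 := Nat.pow_pred_clog_lt_self (b := 2) one_lt_two hx
    have h2 : 0 < Nat.clog 2 x := Nat.clog_pos one_lt_two hx
    calc 2 ^ Nat.clog 2 x = 2 * 2 ^ (Nat.clog 2 x).pred := by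
          rw [← pow_succ', Nat.pred_eq_sub_one, Nat.sub_add_cancel h2]
      _ ≤ _ := by omega

theorem clog_le_log {x : ℕ} (hx : 2 ≤ x) : (Nat.clog 2 x : ℝ) ≤ 3 * Real.log x := by
  have h1 : ((2 ^ Nat.clog 2 x : ℕ) : ℝ) ≤ 2 * x := by
    exact_mod_cast two_pow_clog_le (by omega : 1 ≤ x)
  have hx' : (2 : ℝ) ≤ x := by exact_mod_cast hx
  have h2 := Real.log_le_log (by positivity) h1
  rw [Nat.cast_pow, Real.log_pow, Real.log_mul (by norm_num) (by linarith)] at h2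
  have h3 := Real.log_le_log (by norm_num) hx'
  have h4 := Real.log_two_gt_d9
  push_cast at h2
  nlinarith

theorem exists_sizes {n Q : ℕ} (hnQ : 2 ≤ n * Q) : ∃ Λ s u : ℕ, 1 ≤ Λ ∧ n * Q ≤ 2 ^ Λ ∧
    Q ≤ 2 ^ Λ ∧ (Λ : ℝ) ≤ 3 * Real.log (n * Q) ∧ (Q : ℝ) ≤ ((2 ^ s : ℕ) : ℝ) ^ 2 ∧
    ((2 ^ s : ℕ) : ℝ) ≤ 4 ^ Λ ∧ ((2 ^ s : ℕ) : ℝ) ≤ 4 * √(Q : ℝ) ∧ Λ ≤ 2 ^ u ∧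
    ((2 ^ u : ℕ) : ℝ) ≤ 6 * Real.log (n * Q) ∧ 69 / 100 ≤ Real.log (n * Q) ∧
    1 ≤ √(Q : ℝ) := by
  have hQ1 : 1 ≤ Q := Nat.one_le_iff_ne_zero.2 (by rintro rfl; omega)
  have hn1 : 1 ≤ n := Nat.one_le_iff_ne_zero.2 (by rintro rfl; omega)
  set Λ := Nat.clog 2 (n * Q) with hΛdef
  have hΛ : 1 ≤ Λ := Nat.clog_pos one_lt_two hnQ
  have hnQΛ : n * Q ≤ 2 ^ Λ := Nat.le_pow_clog one_lt_two _
  have hQΛ : Q ≤ 2 ^ Λ := (Nat.le_mul_of_pos_left Q hn1).trans hnQΛ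
  have hnQ' : (2 : ℝ) ≤ n * Q := by exact_mod_cast hnQ
  have hlg2 : 69 / 100 ≤ Real.log (n * Q) := by
    have := Real.log_le_log (by norm_num) hnQ'
    linarith [Real.log_two_gt_d9]
  have hΛlg : (Λ : ℝ) ≤ 3 * Real.log (n * Q) := by
    have := clog_le_log hnQ
    push_cast at this
    exact this
  have hsq1 : 1 ≤ √(Q : ℝ) := by
    rw [Real.one_le_sqrt]
    exact_mod_cast hQ1
  set σ := 2 ^ Nat.clog 2 (Nat.sqrt Q + 1) with hσdef
  have hσ_ge : Nat.sqrt Q + 1 ≤ σ := Nat.le_pow_clog one_lt_two _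
  have hσ_le : σ ≤ 2 * (Nat.sqrt Q + 1) := two_pow_clog_le (by omega)
  have hσsq : (Q : ℝ) ≤ (σ : ℝ) ^ 2 := by
    have h1 := Nat.lt_succ_sqrt Q
    have h2 : Q ≤ σ ^ 2 := by
      rw [sq]
      exact h1.le.trans (Nat.mul_le_mul hσ_ge hσ_ge)
    exact_mod_cast h2
  have hσ0 : (0 : ℝ) < σ := by
    have : 0 < σ := by omega
    exact_mod_cast this
  have hσ4 : (σ : ℝ) ≤ 4 ^ Λ := by
    have h1 : Nat.clog 2 (Nat.sqrt Q + 1) ≤ 2 * Λ := by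
      apply Nat.clog_le_of_le_pow
      have h2 : Nat.sqrt Q ≤ Q := Nat.sqrt_le_self Q
      have h3 : 2 ^ 1 ≤ 2 ^ Λ := Nat.pow_le_pow_right (by norm_num) hΛ
      calc Nat.sqrt Q + 1 ≤ 2 ^ Λ + 2 ^ Λ := by omega
        _ = 2 * 2 ^ Λ := by ring
        _ ≤ 2 ^ Λ * 2 ^ Λ := by gcongr; omega
        _ = 2 ^ (2 * Λ) := by rw [← pow_add, two_mul]
    have h4 : σ ≤ 4 ^ Λ := by
      calc σ ≤ 2 ^ (2 * Λ) := Nat.pow_le_pow_right (by norm_num) h1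
        _ = 4 ^ Λ := by rw [pow_mul]; norm_num
    exact_mod_cast h4
  have hσ_sqrt : (σ : ℝ) ≤ 4 * √(Q : ℝ) := by
    have h1 : (σ : ℝ) ≤ 2 * (Nat.sqrt Q + 1) := by exact_mod_cast hσ_le
    have h2 := Real.nat_sqrt_le_real_sqrt (a := Q)
    linarith
  have hu : ((2 ^ Nat.clog 2 Λ : ℕ) : ℝ) ≤ 2 * Λ := by
    exact_mod_cast two_pow_clog_le hΛ
  exact ⟨Λ, Nat.clog 2 (Nat.sqrt Q + 1), Nat.clog 2 Λ, hΛ, hnQΛ, hQΛ, hΛlg, hσsq, hσ4, hσ_sqrt,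
    Nat.le_pow_clog one_lt_two _, by linarith, hlg2, hsq1⟩

end Parameters

/-! ### Assembly of the data structure. -/

section Main

variable {X : Type*} {w : ℕ}

theorem Prog.one_le_time (p : Prog w) : 1 ≤ p.time := by
  cases p <;> simp [Prog.time]

theorem answersAdaptive_ofCopies (D : DataStructure X w) {l n L N k t : ℕ} [NeZero (n * L)]
    {valid : X → (Fin l → BitVec w) → Set ℕ} (hD : D.AnswersSingle valid (3 / 4))
    (hV : ∀ x q, (valid x q).OrdConnected) (hN : 0 < N) (hNw : N ≤ 2 ^ w)
    (hVN : ∀ x q, ∀ v ∈ valid x q, v < 2 ^ w → v < N)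
    (hr : n * L ∣ 2 ^ w) (h8 : 8 < 2 ^ w) (hrw : n * L < 2 ^ w)
    (hmem : n * L * D.cells < 2 ^ w) (hwork : 6 + 2 * k * (2 * D.work) < 2 ^ w)
    {y : ℝ≥0∞} {δ : ℝ} (hδ : 0 ≤ δ)
    (hy : (ENNReal.ofReal (1 + 6 * ((L : ℝ) / (n * L : ℕ)) ^ 2) ^ (2 * (2 * k))) ^ t *
        (t * ENNReal.ofReal (399 / 400) ^ L) ≤ y ^ 2)
    (hyδ : t * ENNReal.ofReal (N * (999 / 1000) ^ k) + n * y ≤ ENNReal.ofReal δ) :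
    (D.ofCopies (n * L) (6 + 2 * k * (2 * D.work))
      (searchProg (n * L) D.cells D.work D.prog N (2 * k) 6 (fun _ => 1 / (N : ℝ)) [])
      ).AnswersAdaptive valid t (ENNReal.ofReal (1 - δ)) := by
  intro x A
  set D' := D.ofCopies (n * L) (6 + 2 * k * (2 * D.work))
      (searchProg (n * L) D.cells D.work D.prog N (2 * k) 6 (fun _ => 1 / (N : ℝ)) [])
  have hwrong := expect_game_wrong_le (A := A) (P := D.init x) (a := fun m q => D.answer m q)
    (V := valid x) (hD x) (hV x) (hVN x) hy
  set s : Set (List ((Fin l → BitVec w) × BitVec w)) :=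
    {h | ∀ qb ∈ h, qb.2.toNat ∈ valid x qb.1}
  have hs : sᶜ = {g | ∃ x_1 ∈ g, x_1.2.toNat ∉ valid x x_1.1} := by
    ext g
    simp [s]
  have hgame : expect (D'.game x A t) (sᶜ.indicator 1) ≤ ENNReal.ofReal δ := by
    refine le_trans (le_of_eq ?_) (hwrong.trans hyδ)
    rw [DataStructure.game, expect_bind]
    refine (expect_map (iid (D.init x) (n * L))
      (fun f (j : Fin (n * L * D.cells)) => f j.divNat j.modNat)
      (fun M => expect (D'.play M A t []) (sᶜ.indicator 1))).trans ?_
    rw [hs]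
    refine congrArg _ (funext fun M => ?_)
    have hplay := play_eq_playWith D' (fun j : Fin (n * L * D.cells) => M j.divNat j.modNat) A t []
    have hans : D'.answer (l := l) (fun j : Fin (n * L * D.cells) => M j.divNat j.modNat) =
        fun q => robustAnswer N (2 * k) fun j => D.answer (M j) q :=
      funext fun q => answer_ofCopies D hN hNw hr h8 hrw hmem hwork M q
    rw [hans] at hplay
    exact congrArg (fun P => expect P _) hplay
  rw [← ofReal_prob, ENNReal.ofReal_le_ofReal_iff hδ, prob_compl] at hgame
  rw [← expect_indicator, ← ofReal_prob]
  exact ENNReal.ofReal_le_ofReal (by linarith)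

end Main

end RobustDS

set_option maxHeartbeats 1000000 in
theorem mainTheorem2 (c a : ℕ) :
    ∃ (C : ℝ) (κ : ℕ), 0 < C ∧
      ∀ (X : Type*) (w l n Q S T U : ℕ) (valid : X → (Fin l → BitVec w) → Set ℕ)
        (D : RobustDS.DataStructure X w),
        1 ≤ S → 2 ≤ n * Q →
        U ≤ (n * Q) ^ a →
        (∀ x q, (valid x q).OrdConnected ∧ valid x q ⊆ Set.Iio U) →
        C * S * √(Q : ℝ) * Real.log (n * Q) ≤ 2 ^ w →
        D.space ≤ S → D.time ≤ T →
        D.AnswersSingle valid (3 / 4) →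
        ∃ (r work : ℕ) (prog : RobustDS.Prog w),
          (r : ℝ) ≤ C * √(Q : ℝ) * Real.log (n * Q) ∧
          ((D.ofCopies r work prog).space : ℝ) ≤ C * S * √(Q : ℝ) * Real.log (n * Q) ∧
          ((D.ofCopies r work prog).time : ℝ) ≤
            C * (T * Real.log (n * Q) + Real.log (n * Q) ^ 3) *
              Real.log (2 + (T * Real.log (n * Q) + Real.log (n * Q) ^ 3)) ^ κ ∧
          (D.ofCopies r work prog).AnswersAdaptive valid Q
            (ENNReal.ofReal (1 - 1 / ((n : ℝ) * Q) ^ c)) := by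
  obtain ⟨κ, e, l₀, hκ, he, hl₀⟩ := RobustDS.exists_parameters c a
  obtain ⟨C₀, hC₀⟩ : ∃ C₀ : ℝ, C₀ = 24 * 2 ^ e * 2 ^ l₀ + 9 + 12 * κ := ⟨_, rfl⟩
  have hC₀9 : 9 ≤ C₀ := by
    have : (0 : ℝ) ≤ 24 * 2 ^ e * 2 ^ l₀ + 12 * κ := by positivity
    linarith
  have hCpos : 0 < 2 * C₀ + 252 * κ + 3 := by positivity
  -- `C₀` pays for space and `252 * κ + 3` for time. The logarithmic exponent can be 0, as a query
  -- consists of `O(log (nQ))` comparisons of `O(T)` steps each.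
  refine ⟨2 * C₀ + 252 * κ + 3, 0, hCpos, ?_⟩
  intro X w l n Q S T U valid D hS hnQ hU hvalid hw hspace htime hsingle
  generalize hC : 2 * C₀ + 252 * κ + 3 = C at *
  obtain ⟨Λ, s, u, hΛ, hnQΛ, hQΛ, hΛlg, hσsq, hσ4, hσ_sqrt, hΛu, hu, hlg2, hsq1⟩ :=
    RobustDS.exists_sizes hnQ
  generalize hlg : Real.log (n * Q) = lg at *
  have hσ0 : (0 : ℝ) < (2 ^ s : ℕ) := by positivity
  generalize hσdef : 2 ^ s = σ at *
  obtain ⟨L, hLdef⟩ : ∃ L, L = 2 ^ l₀ * 2 ^ u := ⟨_, rfl⟩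
  have hL0 : 0 < L := by rw [hLdef]; positivity
  have hLge : l₀ * Λ ≤ L := hLdef ▸ Nat.mul_le_mul Nat.lt_two_pow_self.le hΛu
  have hLle : (L : ℝ) ≤ 2 ^ l₀ * (6 * lg) := by
    rw [hLdef, Nat.cast_mul, Nat.cast_pow, Nat.cast_ofNat]
    gcongr
  obtain ⟨m, hmdef⟩ : ∃ m, m = 2 ^ e * σ := ⟨_, rfl⟩
  have hm : (m : ℝ) = 2 ^ e * σ := by rw [hmdef]; push_cast; rfl
  obtain ⟨r, hrdef⟩ : ∃ r, r = m * L := ⟨_, rfl⟩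
  have : NeZero (m * L) := by
    refine ⟨Nat.mul_ne_zero ?_ hL0.ne'⟩
    rw [hmdef, ← hσdef]
    positivity
  have hr_le : (r : ℝ) ≤ 24 * 2 ^ e * 2 ^ l₀ * (√(Q : ℝ) * lg) := by
    rw [hrdef, Nat.cast_mul, hm]
    calc (2 : ℝ) ^ e * σ * L ≤ 2 ^ e * (4 * √(Q : ℝ)) * (2 ^ l₀ * (6 * lg)) := by gcongr
      _ = _ := by ring
  obtain ⟨Z, hZ⟩ : ∃ Z : ℝ, Z = √(Q : ℝ) * lg := ⟨_, rfl⟩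
  rw [← hZ] at hr_le
  have hlgZ : lg ≤ Z := hZ ▸ le_mul_of_one_le_left (by linarith) hsq1
  have hS' : (1 : ℝ) ≤ S := by exact_mod_cast hS
  have hcells : D.cells + D.work ≤ S := hspace
  have hcells' : (D.cells : ℝ) ≤ S := by exact_mod_cast (by omega : D.cells ≤ S)
  have hwork' : (D.work : ℝ) ≤ S := by exact_mod_cast (by omega : D.work ≤ S)
  have hSZ : Z ≤ S * Z := le_mul_of_one_le_left (by linarith) hS'
  have hmemR : (r : ℝ) * D.cells ≤ 24 * 2 ^ e * 2 ^ l₀ * (S * Z) := by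
    calc (r : ℝ) * D.cells ≤ 24 * 2 ^ e * 2 ^ l₀ * Z * S := by
          have : 0 ≤ Z := by linarith
          gcongr
      _ = _ := by ring
  have hworkR : ((6 + 2 * (κ * Λ) * (2 * D.work) : ℕ) : ℝ) ≤ (9 + 12 * κ) * (S * Z) := by
    push_cast
    have h1 : (κ : ℝ) * Λ * D.work ≤ κ * (3 * Z) * S := by
      have h2 : (0 : ℝ) ≤ 3 * Z := by linarith
      gcongr
      linarith
    linarith
  have hw' : C * (S * Z) ≤ 2 ^ w := by
    rw [hZ, ← mul_assoc, ← mul_assoc]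
    exact hw
  have hκ0 : (0 : ℝ) ≤ κ := Nat.cast_nonneg κ
  have hSZpos : 0 < S * Z := by linarith
  have hlt : C₀ * (S * Z) < 2 ^ w := by
    have : C₀ * (S * Z) < C * (S * Z) := by
      apply mul_lt_mul_of_pos_right _ hSZpos
      linarith
    linarith
  have hA0 : (0 : ℝ) ≤ 24 * 2 ^ e * 2 ^ l₀ := by positivity
  have hsum : 24 * 2 ^ e * 2 ^ l₀ * (S * Z) + (9 + 12 * κ) * (S * Z) = C₀ * (S * Z) := by
    rw [hC₀]
    ring
  have hA1 : 0 ≤ 24 * 2 ^ e * 2 ^ l₀ * (S * Z) := mul_nonneg hA0 hSZpos.le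
  have hA2 : 9 * (S * Z) ≤ (9 + 12 * κ) * (S * Z) := by
    gcongr
    linarith
  -- The extra `3` gives `2 ^ w ≥ 12 * (69/100) > 8`, needed to draw a residue modulo 8.
  have hA3 : C₀ * (S * Z) + 3 * (S * Z) ≤ C * (S * Z) := by
    rw [← add_mul]
    gcongr
    linarith
  have hA4 := mul_le_mul_of_nonneg_left hSZ hA0
  have hmem : r * D.cells < 2 ^ w := by
    have : (r : ℝ) * D.cells < 2 ^ w := by linarith
    exact_mod_cast this
  have hwork : 6 + 2 * (κ * Λ) * (2 * D.work) < 2 ^ w := by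
    have : ((6 + 2 * (κ * Λ) * (2 * D.work) : ℕ) : ℝ) < 2 ^ w := by linarith
    exact_mod_cast this
  have hrw : r < 2 ^ w := by
    have : (r : ℝ) < 2 ^ w := by linarith
    exact_mod_cast this
  have h8 : 8 < 2 ^ w := by
    have : (8 : ℝ) < 2 ^ w := by linarith
    exact_mod_cast this
  -- All three factors of `r` are powers of two, so `r < 2 ^ w` already implies divisibility.
  have hrdvd : r ∣ 2 ^ w := by
    have hr2 : r = 2 ^ (e + s + (l₀ + u)) := by
      rw [hrdef, hmdef, hLdef, ← hσdef]
      simp only [pow_add]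
    rw [hr2] at hrw ⊢
    exact pow_dvd_pow 2 ((Nat.pow_lt_pow_iff_right one_lt_two).1 hrw).le
  -- Six registers plus a fresh workspace block for each of the `4κΛ` comparisons; the search range
  -- is capped at `2 ^ w` so that thresholds fit the machine.
  refine ⟨r, 6 + 2 * (κ * Λ) * (2 * D.work), RobustDS.searchProg r D.cells D.work D.prog
    (min (2 ^ (a * Λ)) (2 ^ w)) (2 * (κ * Λ)) 6
      (fun _ => 1 / ((min (2 ^ (a * Λ)) (2 ^ w) : ℕ) : ℝ)) [], ?_, ?_, ?_, ?_⟩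
  · rw [mul_assoc, ← hZ]
    refine hr_le.trans (mul_le_mul_of_nonneg_right ?_ (by linarith))
    linarith
  · have e1 : ((D.ofCopies r (6 + 2 * (κ * Λ) * (2 * D.work)) (RobustDS.searchProg r D.cells
        D.work D.prog (min (2 ^ (a * Λ)) (2 ^ w)) (2 * (κ * Λ)) 6
        (fun _ => 1 / ((min (2 ^ (a * Λ)) (2 ^ w) : ℕ) : ℝ)) [])).space : ℝ) =
        r * D.cells + (6 + 2 * (κ * Λ) * (2 * D.work) : ℕ) := by
      rw [RobustDS.DataStructure.space, Nat.cast_add]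
      congr 1
      exact Nat.cast_mul r D.cells
    have e2 : C * S * √(Q : ℝ) * lg = C * (S * Z) := by
      rw [hZ]
      ring
    rw [e1, e2]
    linarith
  · rw [pow_zero, mul_one]
    have h1 := RobustDS.time_searchProg_le r D.cells D.work D.prog (min (2 ^ (a * Λ)) (2 ^ w))
      (2 * (κ * Λ)) 6 (fun _ => 1 / ((min (2 ^ (a * Λ)) (2 ^ w) : ℕ) : ℝ)) []
    have h2 := D.prog.one_le_time
    have hT : D.prog.time ≤ T := htime
    have h3 : 2 * (κ * Λ) * (2 * (6 * D.prog.time + 15)) + 2 ≤ 84 * (κ * Λ * T) + 2 := by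
      calc _ ≤ 2 * (κ * Λ) * (2 * (21 * T)) + 2 := by
            gcongr
            omega
        _ = _ := by ring
    have hT1 : (1 : ℝ) ≤ T := by exact_mod_cast h2.trans hT
    have h5 : (κ : ℝ) * Λ * T ≤ κ * (3 * lg) * T := by gcongr
    have h6 : lg ≤ T * lg := le_mul_of_one_le_left (by linarith) hT1
    have h7 : (0 : ℝ) ≤ lg ^ 3 := by positivity
    have h8 : 0 ≤ T * lg := by positivity
    refine (Nat.cast_le.2 (h1.trans h3)).trans ?_
    push_cast
    calc (84 : ℝ) * (κ * Λ * T) + 2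
      _ ≤ (252 * κ + 3) * (T * lg) := by nlinarith
      _ ≤ C * (T * lg + lg ^ 3) := by
          apply mul_le_mul _ (by linarith) h8 (by positivity)
          linarith
  · have hN2 : min (2 ^ (a * Λ)) (2 ^ w) ≤ 2 ^ (a * Λ) := min_le_left _ _
    have hδ : (1 / 2 : ℝ) ^ (c * Λ) ≤ 1 / ((n : ℝ) * Q) ^ c := by
      rw [div_pow, one_pow, mul_comm c, pow_mul]
      have h1 : (n : ℝ) * Q ≤ 2 ^ Λ := by exact_mod_cast hnQΛ
      have h3 : (2 : ℝ) ≤ n * Q := by exact_mod_cast hnQ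
      have h2 : 0 < (n : ℝ) * Q := by linarith
      exact one_div_le_one_div_of_le (pow_pos h2 c) (pow_le_pow_left₀ h2.le h1 c)
    have h2e : (1 : ℝ) ≤ 2 ^ e := one_le_pow₀ (by norm_num)
    subst hrdef
    refine RobustDS.answersAdaptive_ofCopies D hsingle (fun x q => (hvalid x q).1)
      (by positivity) (min_le_right _ _) (fun x q v hv hvw => lt_min ?_ hvw) hrdvd h8 hrw hmem
      hwork (by positivity)
      (RobustDS.bad_sq_le hL0 hm he h2e hσ0 hσsq hQΛ hLge (by positivity) hl₀)
      ((RobustDS.total_failure_le hΛ hm h2e hσ0 hσ4 hQΛ hN2 hκ rfl).trans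
        (ENNReal.ofReal_le_ofReal hδ))
    calc v < U := (hvalid x q).2 hv
      _ ≤ (n * Q) ^ a := hU
      _ ≤ (2 ^ Λ) ^ a := Nat.pow_le_pow_left hnQΛ a
      _ = 2 ^ (a * Λ) := by rw [← pow_mul, mul_comm]
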